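/- All Banach spaces are real. **Gurarij spaces.** A separable Banach space $G$ is a *Gurarij space* if for every $\varepsilon>0$, every finite-dimensional Banach space $F$ with a subspace $E\subseteq F$, and every linear isometric embedding $\psi\colon E\to G$, there is an injective linear map $\varphi\colon F\to G$ extending $\psi$ such that $(1-\varepsilon)\|x\|<\|\varphi x\|<(1+\varepsilon)\|x\|$ for all $x\in F\setminus\{0\}$. **Approximate isometries.** For metric spaces $X,Y$, an *approximate isometry* $\psi\colon X\rightsquigarrow Y$ is a function $\psi\colon X\times Y\to[0,\infty]$ such that each of its sections $\theta$ (in either argument) satisfies $\theta(u)\le d(u,v)+\theta(v)$ and $d(u,v)\le\theta(u)+\theta(v)$. They form a space $\mathrm{Apx}(X,Y)\subseteq[0,\infty]^{X\times Y}$ with the product topology and the pointwise order; $\varphi<\psi$ means that $\varphi$ lies in the interior of $\{\rho\in\mathrm{Apx}(X,Y):\rho\le\psi\}$. Composition is $\varphi\psi(x,z)=\inf_y\,\psi(x,y)+\varphi(y,z)$. A map $f\colon D\to Y$ with $D\subseteq X$ is identified with $f(x,y)=\inf_{z\in D}d(x,z)+d(fz,y)$. For $X_0\subseteq X$, $Y_0\subseteq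 Y$, the *trivial extension* of $\psi\colon X_0\rightsquigarrow Y_0$ to $X\rightsquigarrow Y$ is $(x,y)\mapsto\inf_{a\in X_0,\,b\in Y_0}d(x,a)+\psi(a,b)+d(b,y)$. One calls $\psi\colon X\rightsquigarrow Y$ *$r$-total on $A_0\subseteq X$* if for all $x\in A_0$ and $s>r$ there is $y\in Y$ with $\psi(x,y)<s$. **Structures.** A structure (in a language of predicate and function symbols with arities) is a complete metric space with a continuous real-valued (resp. space-valued) interpretation of each predicate (resp. function) symbol; the distance counts as a predicate. Embeddings preserve the distance and all symbols; $\langle A_0\rangle$ denotes the smallest closed substructure containing $A_0$. A *finite partial isomorphism* $\mathfrak A\dashrightarrow\mathfrak B$ is a map from a finite $A_0\subseteq A$ to $B$ which extends to an embedding of $\langle A_0\rangle$ in $\mathfrak B$. $\mathrm{Age}(\mathfrak A)$ is the class of finitely generated structures which embed in $\mathfrak A$. Let $\mathcal K$ be a class of finitely generated structures. A *$\mathcal K$-structure* is a structure whose age is contained in $\mathcal K$. For structures $\mathfrak A,\mathfrak B$, let $\mathrm{Apx}_2(\mathfrak A,\mathfrak B)$ be the set of compositions $fg$ of finite partial isomorphisms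 $g\colon\mathfrak A\dashrightarrow\mathfrak C$, $f\colon\mathfrak C\dashrightarrow\mathfrak B$ with $\mathfrak C\in\mathcal K$; let $\mathrm{Apx}(\mathfrak A,\mathfrak B)$ be the closure of the set of all approximate isometries $\psi\ge\varphi$ with $\varphi\in\mathrm{Apx}_2(\mathfrak A,\mathfrak B)$; and let $\mathrm{Stx}(\mathfrak A,\mathfrak B)$ be the set of $\psi\in\mathrm{Apx}(\mathfrak A,\mathfrak B)$ such that $\varphi<\psi$ for some $\varphi\in\mathrm{Apx}(\mathfrak A,\mathfrak B)$. Let $\mathcal K_n$ be the class of $n$-tuples $\bar a$ together with a member $\langle\bar a\rangle$ of $\mathcal K$ which they generate, and put $d^{\mathcal K}(\bar a,\bar b)=\inf_\psi\max_i\psi(a_i,b_i)$, where $\psi$ ranges over those members of $\mathrm{Stx}(\langle\bar a\rangle,\langle\bar b\rangle)$ which are trivial extensions of an approximate isometry $\bar a\rightsquigarrow\bar b$. **Fraïssé classes.** $\mathcal K$ is a *Fraïssé class* if * (HP) every member of $\mathcal K$ is a $\mathcal K$-structure; * (JEP) any two members of $\mathcal K$ embed in a third one; * (NAP) for all $\mathfrak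 A,\mathfrak B\in\mathcal K$, every finite partial isomorphism $f\colon\mathfrak A\dashrightarrow\mathfrak B$ and every $\varepsilon>0$, there are $\mathfrak C\in\mathcal K$ and embeddings $g\colon\mathfrak A\to\mathfrak C$, $h\colon\mathfrak B\to\mathfrak C$ with $d(ga,hfa)\le\varepsilon$ for all $a\in\operatorname{dom}f$; * (PP) $d^{\mathcal K}$ is separable and complete on every $\mathcal K_n$; * (CP) every symbol is continuous on $\mathcal K$: for every $n$-ary predicate $P$ the map $\bar a\mapsto P(\bar a)$ is continuous on $\mathcal K_n$, and for every $n$-ary function symbol $f$ and every $m$ the map $(\bar a,\bar b)\mapsto(\bar a,\bar b,f(\bar a))$ from $\mathcal K_{n+m}$ to $\mathcal K_{n+m+1}$ is continuous. A *(Fraïssé) limit* of $\mathcal K$ is a separable $\mathcal K$-structure $\mathfrak M$ such that for every $\mathcal K$-structure $\mathfrak A$, finite $A_0\subseteq A$, $\psi\in\mathrm{Stx}(\mathfrak A,\mathfrak M)$ and $\varepsilon>0$, there is $\varphi\in\mathrm{Stx}(\mathfrak A,\mathfrak M)$ with $\varphi<\psi$ which is $\varepsilon$-total on $A_0$. View Banach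 spaces as structures, with symbols for $0$, addition, multiplication by each real scalar, and the norm, and let $\mathcal K_B$ be the class of (structures isomorphic to) finite-dimensional Banach spaces. **Theorem.** The class $\mathcal K_B$ is a Fraïssé class, and a Banach space $G$ is a Gurarij space if and only if it is a Fraïssé limit of $\mathcal K_B$. Moreover, a Gurarij space exists; any two Gurarij spaces are linearly isometrically isomorphic; and every separable Banach space embeds linearly and isometrically in every Gurarij space. -/

import Mathlib

open scoped ENNReal
open Set Topology

universe u

namespace MetricFraisse

/-! ### Approximate isometries -/

section ApproximateIsometries

variable {X Y Z : Type*}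

/-- A `[0,∞]`-valued Katětov function. -/
def IsKatetov [MetricSpace X] (ψ : X → ℝ≥0∞) : Prop :=
  ∀ x y, ψ x ≤ edist x y + ψ y ∧ edist x y ≤ ψ x + ψ y

/-- Bi-Katětov functions, i.e. approximate isometries `ψ : X ⇝ Y`. -/
def IsApproxIsometry [MetricSpace X] [MetricSpace Y] (ψ : X → Y → ℝ≥0∞) : Prop :=
  (∀ y, IsKatetov fun x => ψ x y) ∧ ∀ x, IsKatetov (ψ x)

/-- The composition `φψ`, where `ψ : X ⇝ Y` and `φ : Y ⇝ Z`. -/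
noncomputable def comp (φ : Y → Z → ℝ≥0∞) (ψ : X → Y → ℝ≥0∞) : X → Z → ℝ≥0∞ :=
  fun x z => ⨅ y, ψ x y + φ y z

/-- The approximate isometry associated with a map `f` from a subset `D` of `X` to `Y`. -/
noncomputable def ofPartialMap [MetricSpace X] [MetricSpace Y] {D : Set X} (f : D → Y) :
    X → Y → ℝ≥0∞ :=
  fun x y => ⨅ z : D, edist x z + edist (f z) y

/-- The trivial extension to `X ⇝ Y` of `ψ : X₀ ⇝ Y₀`, where `X₀ ⊆ X` and `Y₀ ⊆ Y`. -/
noncomputable def trivialExtension [MetricSpace X] [MetricSpace Y] {X₀ : Set X} {Y₀ : Set Y}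
    (ψ : X₀ → Y₀ → ℝ≥0∞) : X → Y → ℝ≥0∞ :=
  fun x y => ⨅ (a : X₀) (b : Y₀), edist x a + ψ a b + edist (b : Y) y

/-- The space of approximate isometries from `X` to `Y`, with the pointwise order and with the
topology induced from the product `[0,∞]^(X × Y)`. -/
abbrev Apx (X Y : Type*) [MetricSpace X] [MetricSpace Y] : Type _ :=
  {ψ : X → Y → ℝ≥0∞ // IsApproxIsometry ψ}

/-- `φ < ψ`: the approximate isometry `φ` lies in the interior, in `Apx X Y`,
of the set of all approximate isometries refining `ψ`. -/
def StrictlyRefines [MetricSpace X] [MetricSpace Y] (φ ψ : Apx X Y) : Prop :=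
  φ ∈ interior {ρ : Apx X Y | ρ ≤ ψ}

/-- `ψ` is `r`-total on the set `X₀`. -/
def IsTotalOn [MetricSpace X] [MetricSpace Y] (r : ℝ) (X₀ : Set X) (ψ : Apx X Y) : Prop :=
  ∀ x ∈ X₀, ∀ s : ℝ≥0∞, ENNReal.ofReal r < s → ∃ y, ψ.1 x y < s

end ApproximateIsometries

/-! ### Metric structures -/

/-- A metric structure in a language `L` whose relation symbols are read as real-valued predicate
symbols. The distance is a distinguished binary predicate. -/
structure MetricStructure (L : FirstOrder.Language.{0, 0}) where
  carrier : Type u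
  [metric : MetricSpace carrier]
  [complete : CompleteSpace carrier]
  relMap : ∀ {n : ℕ}, L.Relations n → (Fin n → carrier) → ℝ
  funMap : ∀ {n : ℕ}, L.Functions n → (Fin n → carrier) → carrier
  continuous_relMap : ∀ {n : ℕ} (R : L.Relations n), Continuous (relMap R)
  continuous_funMap : ∀ {n : ℕ} (f : L.Functions n), Continuous (funMap f)

attribute [instance] MetricStructure.metric MetricStructure.complete

instance (L : FirstOrder.Language.{0, 0}) : CoeSort (MetricStructure.{u} L) (Type u) :=
  ⟨MetricStructure.carrier⟩

variable {L : FirstOrder.Language.{0, 0}}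

/-- Embeddings of metric structures. -/
structure Embedding (A B : MetricStructure.{u} L) where
  toFun : A → B
  dist_eq : ∀ x y, dist (toFun x) (toFun y) = dist x y
  map_rel : ∀ {n : ℕ} (R : L.Relations n) (a : Fin n → A),
    B.relMap R (fun i => toFun (a i)) = A.relMap R a
  map_fun : ∀ {n : ℕ} (f : L.Functions n) (a : Fin n → A),
    B.funMap f (fun i => toFun (a i)) = toFun (A.funMap f a)

/-- `S` is the underlying set of a substructure: it is closed, and stable under the functions. -/
def IsSubstructure (A : MetricStructure.{u} L) (S : Set A) : Prop :=
  IsClosed S ∧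
    ∀ {n : ℕ} (f : L.Functions n) (a : Fin n → A), (∀ i, a i ∈ S) → A.funMap f a ∈ S

/-- The underlying set of the substructure `⟨A₀⟩` generated by `A₀`. -/
def generatedSet (A : MetricStructure.{u} L) (A₀ : Set A) : Set A :=
  ⋂₀ {S | IsSubstructure A S ∧ A₀ ⊆ S}

theorem subset_generatedSet (A : MetricStructure.{u} L) (A₀ : Set A) :
    A₀ ⊆ generatedSet A A₀ :=
  fun _ hx _ hS => hS.2 hx

theorem isSubstructure_generatedSet (A : MetricStructure.{u} L) (A₀ : Set A) :
    IsSubstructure A (generatedSet A A₀) :=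
  ⟨isClosed_sInter fun _ hS => hS.1.1,
    fun f a ha _ hS => hS.1.2 f a fun i => ha i _ hS⟩

theorem generatedSet_mono (A : MetricStructure.{u} L) {S T : Set A} (h : S ⊆ T) :
    generatedSet A S ⊆ generatedSet A T :=
  fun _ hx U hU => hx U ⟨hU.1, h.trans hU.2⟩

/-- The substructure of `A` with underlying set `S`. -/
def substructure (A : MetricStructure.{u} L) (S : Set A) (hS : IsSubstructure A S) :
    MetricStructure.{u} L where
  carrier := S
  complete := hS.1.completeSpace_coe
  relMap R a := A.relMap R fun i => (a i : A)
  funMap f a := ⟨A.funMap f fun i => (a i : A), hS.2 f _ fun i => (a i).2⟩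
  continuous_relMap R := (A.continuous_relMap R).comp (by fun_prop)
  continuous_funMap f :=
    ((A.continuous_funMap f).comp (by fun_prop : Continuous fun (a : Fin _ → S) i =>
      (a i : A))).subtype_mk _

/-- The substructure `⟨A₀⟩` generated by `A₀`. -/
def generated (A : MetricStructure.{u} L) (A₀ : Set A) : MetricStructure.{u} L :=
  substructure A (generatedSet A A₀) (isSubstructure_generatedSet A A₀)

/-- An element of `A₀`, seen in the substructure generated by `A₀`. -/
def toGenerated (A : MetricStructure.{u} L) {A₀ : Set A} (a : A₀) : generated A A₀ :=
  ⟨a.1, subset_generatedSet A A₀ a.2⟩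

/-- Finitely generated structures. -/
def IsFG (A : MetricStructure.{u} L) : Prop :=
  ∃ A₀ : Set A, A₀.Finite ∧ generatedSet A A₀ = univ

/-- The age of `A`: the class of finitely generated structures which embed in `A`. -/
def Age (A : MetricStructure.{u} L) : Set (MetricStructure.{u} L) :=
  {E | IsFG E ∧ Nonempty (Embedding E A)}

/-- A finite partial isomorphism `A ⇢ B`: a map from a finite subset `dom` of `A` to `B` which
extends to an embedding of `⟨dom⟩` in `B`. -/
structure FinitePartialIso (A B : MetricStructure.{u} L) where
  dom : Set A
  finite_dom : dom.Finite
  toFun : dom → B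
  extends_to_embedding :
    ∃ F : Embedding (generated A dom) B, ∀ a : dom, F.toFun (toGenerated A a) = toFun a

/-! ### Fraïssé classes and their limits -/

/-- `A` is a `K`-structure. -/
def IsKStructure (K : Set (MetricStructure.{u} L)) (A : MetricStructure.{u} L) : Prop :=
  Age A ⊆ K

/-- `Apx₂`: compositions of two finite partial isomorphisms through some member of `K`. -/
def Apx₂ (K : Set (MetricStructure.{u} L)) (A B : MetricStructure.{u} L) : Set (Apx A B) :=
  {ψ | ∃ C ∈ K, ∃ (g : FinitePartialIso A C) (f : FinitePartialIso C B),
    ψ.1 = comp (ofPartialMap f.toFun) (ofPartialMap g.toFun)}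

/-- The (`K`-intrinsic) approximate isomorphisms from `A` to `B`: the closure of the set of all
coarsenings of members of `Apx₂`. -/
def ApxIso (K : Set (MetricStructure.{u} L)) (A B : MetricStructure.{u} L) : Set (Apx A B) :=
  closure {ψ | ∃ φ ∈ Apx₂ K A B, φ ≤ ψ}

/-- The strictly approximate isomorphisms from `A` to `B`. -/
def Stx (K : Set (MetricStructure.{u} L)) (A B : MetricStructure.{u} L) : Set (Apx A B) :=
  {ψ | ψ ∈ ApxIso K A B ∧ ∃ φ ∈ ApxIso K A B, StrictlyRefines φ ψ}

/-- `K_n`: the members of `K`, each with a generating `n`-tuple. -/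
structure GenTuple (K : Set (MetricStructure.{u} L)) (n : ℕ) where
  str : MetricStructure.{u} L
  mem : str ∈ K
  tuple : Fin n → str
  generates : generatedSet str (range tuple) = univ

/-- `Stx(a, b)` for generating tuples `a` and `b`: the strictly approximate isomorphisms
`⟨a⟩ ⇝ ⟨b⟩` which are trivial extensions of an approximate isometry `a ⇝ b`. -/
def StxTuple {K : Set (MetricStructure.{u} L)} {n : ℕ} (a b : GenTuple K n) :
    Set (Apx a.str b.str) :=
  {ψ | ψ ∈ Stx K a.str b.str ∧ ∃ ψ₀ : Apx (range a.tuple) (range b.tuple),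
    ψ.1 = trivialExtension ψ₀.1}

/-- The pseudo-distance `d^K` on `K_n`. -/
noncomputable def intrinsicDist {K : Set (MetricStructure.{u} L)} {n : ℕ} (a b : GenTuple K n) :
    ℝ≥0∞ :=
  ⨅ ψ ∈ StxTuple a b, ⨆ i, ψ.1 (a.tuple i) (b.tuple i)

/-- Hereditary property. -/
def HasHP (K : Set (MetricStructure.{u} L)) : Prop :=
  ∀ A ∈ K, IsKStructure K A

/-- Joint embedding property. -/
def HasJEP (K : Set (MetricStructure.{u} L)) : Prop :=
  ∀ A ∈ K, ∀ B ∈ K, ∃ C ∈ K, Nonempty (Embedding A C) ∧ Nonempty (Embedding B C)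

/-- Near amalgamation property. -/
def HasNAP (K : Set (MetricStructure.{u} L)) : Prop :=
  ∀ A ∈ K, ∀ B ∈ K, ∀ (f : FinitePartialIso A B) (ε : ℝ), 0 < ε →
    ∃ C ∈ K, ∃ (g : Embedding A C) (h : Embedding B C),
      ∀ a : f.dom, dist (g.toFun a) (h.toFun (f.toFun a)) ≤ ε

/-- Polish property: `d^K` is separable and complete on each `K_n`. -/
def HasPP (K : Set (MetricStructure.{u} L)) : Prop :=
  ∀ n : ℕ,
    (∃ S : Set (GenTuple K n), S.Countable ∧
      ∀ (a : GenTuple K n) (ε : ℝ≥0∞), 0 < ε → ∃ b ∈ S, intrinsicDist a b < ε) ∧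
    (∀ a : ℕ → GenTuple K n,
      (∀ ε : ℝ≥0∞, 0 < ε → ∃ N, ∀ i ≥ N, ∀ j ≥ N, intrinsicDist (a i) (a j) < ε) →
      ∃ b : GenTuple K n, ∀ ε : ℝ≥0∞, 0 < ε → ∃ N, ∀ i ≥ N, intrinsicDist (a i) b < ε)

/-- Append to a generating tuple the value of a function symbol at its first `n` entries. -/
def GenTuple.appendFun {K : Set (MetricStructure.{u} L)} {n m : ℕ} (f : L.Functions n)
    (a : GenTuple K (n + m)) : GenTuple K (n + m + 1) where
  str := a.str
  mem := a.mem
  tuple := Fin.snoc (α := fun _ => a.str.carrier) a.tuple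
    (a.str.funMap f fun i => a.tuple (Fin.castAdd m i))
  generates := by
    refine eq_univ_of_univ_subset (a.generates.symm.subset.trans (generatedSet_mono _ ?_))
    rintro _ ⟨i, rfl⟩
    exact ⟨i.castSucc, by simp⟩

/-- Continuity property: every symbol, including the distance, is continuous on `K`. -/
def HasCP (K : Set (MetricStructure.{u} L)) : Prop :=
  (∀ (a : GenTuple K 2) (ε : ℝ), 0 < ε → ∃ δ : ℝ≥0∞, 0 < δ ∧ ∀ b : GenTuple K 2,
    intrinsicDist a b < δ → |dist (a.tuple 0) (a.tuple 1) - dist (b.tuple 0) (b.tuple 1)| < ε) ∧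
  (∀ (n : ℕ) (R : L.Relations n) (a : GenTuple K n) (ε : ℝ), 0 < ε →
    ∃ δ : ℝ≥0∞, 0 < δ ∧ ∀ b : GenTuple K n,
      intrinsicDist a b < δ → |a.str.relMap R a.tuple - b.str.relMap R b.tuple| < ε) ∧
  (∀ (n m : ℕ) (f : L.Functions n) (a : GenTuple K (n + m)) (ε : ℝ≥0∞), 0 < ε →
    ∃ δ : ℝ≥0∞, 0 < δ ∧ ∀ b : GenTuple K (n + m),
      intrinsicDist a b < δ → intrinsicDist (a.appendFun f) (b.appendFun f) < ε)

/-- Fraïssé classes of metric structures. -/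
structure IsFraisseClass (K : Set (MetricStructure.{u} L)) : Prop where
  fg : ∀ A ∈ K, IsFG A
  hp : HasHP K
  jep : HasJEP K
  nap : HasNAP K
  pp : HasPP K
  cp : HasCP K

/-- `M` is a limit of the class `K`. -/
structure IsFraisseLimit (K : Set (MetricStructure.{u} L)) (M : MetricStructure.{u} L) :
    Prop where
  separable : TopologicalSpace.SeparableSpace M
  isKStructure : IsKStructure K M
  exists_total : ∀ A : MetricStructure.{u} L, IsKStructure K A → ∀ A₀ : Set A, A₀.Finite →
    ∀ ψ ∈ Stx K A M, ∀ ε : ℝ, 0 < ε →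
      ∃ φ ∈ Stx K A M, StrictlyRefines φ ψ ∧ IsTotalOn ε A₀ φ

/-! ### Banach spaces as metric structures -/

/-- The function symbols of Banach spaces: zero, addition, and multiplication by each scalar. -/
inductive BanachFunctions : ℕ → Type
  | zero : BanachFunctions 0
  | add : BanachFunctions 2
  | smul (r : ℝ) : BanachFunctions 1

/-- The predicate symbol of Banach spaces, besides the distance: the norm. -/
inductive BanachRelations : ℕ → Type
  | norm : BanachRelations 1

/-- The language of real Banach spaces. -/
def banachLanguage : FirstOrder.Language.{0, 0} := ⟨BanachFunctions, BanachRelations⟩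

section Banach

variable (X : Type u) [NormedAddCommGroup X] [NormedSpace ℝ X]

/-- The interpretation of the function symbols in a Banach space. -/
def banachFunMap : ∀ {n : ℕ}, BanachFunctions n → (Fin n → X) → X
  | _, .zero, _ => 0
  | _, .add, v => v 0 + v 1
  | _, .smul r, v => r • v 0

/-- The interpretation of the norm symbol in a Banach space. -/
noncomputable def banachRelMap : ∀ {n : ℕ}, BanachRelations n → (Fin n → X) → ℝ
  | _, .norm, v => ‖v 0‖

/-- A real Banach space as a metric structure. -/
noncomputable def banachStructure [CompleteSpace X] : MetricStructure.{u} banachLanguage where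
  carrier := X
  relMap := banachRelMap X
  funMap := banachFunMap X
  continuous_relMap R := by
    cases R
    exact (continuous_apply 0).norm
  continuous_funMap f := by
    cases f with
    | zero => exact continuous_const
    | add => exact (continuous_apply 0).add (continuous_apply 1)
    | smul r => exact (continuous_apply 0).const_smul r

end Banach

/-- The class of finite-dimensional real Banach spaces, as metric structures up to isomorphism. -/
def finDimBanach : Set (MetricStructure.{u} banachLanguage) :=
  {A | ∃ (X : Type u) (_ : NormedAddCommGroup X) (_ : NormedSpace ℝ X) (_ : CompleteSpace X),
    FiniteDimensional ℝ X ∧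
      ∃ e : Embedding (banachStructure X) A, Function.Surjective e.toFun}

/-- Gurarij spaces. -/
def IsGurarij (G : Type u) [NormedAddCommGroup G] [NormedSpace ℝ G] : Prop :=
  CompleteSpace G ∧ TopologicalSpace.SeparableSpace G ∧
  ∀ ε : ℝ, 0 < ε →
    ∀ (F : Type u) [NormedAddCommGroup F] [NormedSpace ℝ F] [FiniteDimensional ℝ F]
      (E : Submodule ℝ F) (ψ : E →ₗᵢ[ℝ] G),
      ∃ φ : F →ₗ[ℝ] G, Function.Injective φ ∧ (∀ x : E, φ x = ψ x) ∧
        ∀ x : F, x ≠ 0 → (1 - ε) * ‖x‖ < ‖φ x‖ ∧ ‖φ x‖ < (1 + ε) * ‖x‖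

end MetricFraisse

namespace MetricFraisse

/-! ### Amalgamation of normed spaces -/

/-! Everything rests on one amalgamation. If linear maps `T : V → X` and `S : V → Y` satisfy `|‖T v‖
- ‖S v‖| ≤ ε‖v‖`, then the seminorm `inf_v ‖x - T v‖ + ‖y + S v‖ + ε‖v‖` on `X × Y` restricts to the
given norms on both factors and puts `T v` within `ε‖v‖` of `S v` (`exists_amalgam`).

For Banach spaces the metric-structure notions then become linear. The structures whose age consists
of finite-dimensional spaces are exactly the Banach spaces (`isKStructure_iff`). Strictly
approximate isomorphisms are controlled by joint embeddings `i, j` into a common space: relaxing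
`edist (i x) (j y)` by `ε > 0` on finitely many pairs gives one (`relax_mem_stx`), and each of them
lies above such a relaxation (`exists_relax_le_of_mem_stx`). Hence `intrinsicDist` measures how
close two tuples get in a joint embedding. By amalgamation this distance is equivalent to the sup
distance, on the unit ball of `ℝⁿ`, of the seminorms which the tuples induce. The Polish property
becomes separability and completeness of a set of seminorms; the other axioms are direct.

An amalgam of a Gurarij space `G` with another space retracts almost isometrically onto `G` over
finite-dimensional subspaces (`IsGurarij.exists_retract`). Thus almost isometric maps into `G` can
be corrected and extended at a cost proportional to their defect, and geometric errors sum: going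
forth embeds every separable space, going back and forth gives uniqueness. The same retraction
yields the limit property. Conversely, the limit property extends isometries up to a small error on
a basis, and `isGurarij_of_approx` makes the extension exact by redefining it on the subspace.

Existence is a Baire category argument. Seminorms on finitely supported sequences dominated by the
`ℓ¹`-norm form a compact space; each approximate extension task is met on an open dense set,
countably many tasks suffice, and the completion for a generic seminorm is Gurarij. -/

/-- The Hausdorff quotient of a seminormed space. -/
theorem exists_normed_of_seminorm {W : Type u} [AddCommGroup W] [Module ℝ W] (p : Seminorm ℝ W) :
    ∃ (D : Type u) (_ : NormedAddCommGroup D) (_ : NormedSpace ℝ D) (π : W →ₗ[ℝ] D),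
      Function.Surjective π ∧ ∀ w, ‖π w‖ = p w := by
  let i1 : SeminormedAddCommGroup W := p.toAddGroupSeminorm.toSeminormedAddCommGroup
  let i2 : NormedSpace ℝ W := { norm_smul_le := fun a b => (map_smul_eq_mul p a b).le }
  exact ⟨SeparationQuotient W, inferInstance, inferInstance,
    (SeparationQuotient.mkCLM ℝ W).toLinearMap, SeparationQuotient.surjective_mk, fun w => rfl⟩

section Amalgam

variable {X Y V : Type*} [NormedAddCommGroup X] [NormedSpace ℝ X]
  [NormedAddCommGroup Y] [NormedSpace ℝ Y] [SeminormedAddCommGroup V] [NormedSpace ℝ V]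

/-- The amalgamated seminorm on `X × Y` identifying `T v` with `S v` up to `ε * ‖v‖`. -/
noncomputable def amalgamSeminorm (T : V →ₗ[ℝ] X) (S : V →ₗ[ℝ] Y) {ε : ℝ} (hε : 0 ≤ ε) :
    Seminorm ℝ (X × Y) :=
  have bdd : ∀ z : X × Y,
      BddBelow (range fun v => ‖z.1 - T v‖ + ‖z.2 + S v‖ + ε * ‖v‖) := fun z =>
    ⟨0, by rintro _ ⟨v, rfl⟩; positivity⟩
  Seminorm.ofSMulLE (fun z => ⨅ v, (‖z.1 - T v‖ + ‖z.2 + S v‖ + ε * ‖v‖))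
    (le_antisymm (ciInf_le_of_le (bdd 0) 0 (by simp))
      (le_ciInf fun v => by positivity))
    (by
      intro z w
      refine le_ciInf_add_ciInf fun v v' => ciInf_le_of_le (bdd _) (v + v') ?_
      have h1 : ‖(z + w).1 - T (v + v')‖ ≤ ‖z.1 - T v‖ + ‖w.1 - T v'‖ := by
        refine le_trans (le_of_eq ?_) (norm_add_le _ _)
        rw [map_add, Prod.fst_add]; congr 1; abel
      have h2 : ‖(z + w).2 + S (v + v')‖ ≤ ‖z.2 + S v‖ + ‖w.2 + S v'‖ := by
        refine le_trans (le_of_eq ?_) (norm_add_le _ _)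
        rw [map_add, Prod.snd_add]; congr 1; abel
      have h3 := mul_le_mul_of_nonneg_left (norm_add_le v v') hε
      linarith)
    (by
      intro r z
      rw [Real.mul_iInf_of_nonneg (norm_nonneg r)]
      refine le_ciInf fun v => ciInf_le_of_le (bdd _) (r • v) (le_of_eq ?_)
      have h1 : (r • z).1 - T (r • v) = r • (z.1 - T v) := by simp [smul_sub]
      have h2 : (r • z).2 + S (r • v) = r • (z.2 + S v) := by simp [smul_add]
      rw [h1, h2, norm_smul, norm_smul, norm_smul]
      ring)

theorem amalgamSeminorm_le (T : V →ₗ[ℝ] X) (S : V →ₗ[ℝ] Y) {ε : ℝ} (hε : 0 ≤ ε) (z : X × Y)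
    (v : V) : amalgamSeminorm T S hε z ≤ ‖z.1 - T v‖ + ‖z.2 + S v‖ + ε * ‖v‖ :=
  ciInf_le (f := fun v => ‖z.1 - T v‖ + ‖z.2 + S v‖ + ε * ‖v‖)
    ⟨0, by rintro _ ⟨v, rfl⟩; positivity⟩ v

theorem le_amalgamSeminorm (T : V →ₗ[ℝ] X) (S : V →ₗ[ℝ] Y) {ε : ℝ} (hε : 0 ≤ ε) (z : X × Y)
    {r : ℝ} (h : ∀ v, r ≤ ‖z.1 - T v‖ + ‖z.2 + S v‖ + ε * ‖v‖) :
    r ≤ amalgamSeminorm T S hε z :=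
  le_ciInf (f := fun v => ‖z.1 - T v‖ + ‖z.2 + S v‖ + ε * ‖v‖) h

end Amalgam

/-- Two normed spaces can be amalgamated over a pair of maps whose norms almost agree. -/
theorem exists_amalgam {X Y : Type u} {V : Type*} [NormedAddCommGroup X] [NormedSpace ℝ X]
    [NormedAddCommGroup Y] [NormedSpace ℝ Y] [SeminormedAddCommGroup V] [NormedSpace ℝ V]
    (T : V →ₗ[ℝ] X) (S : V →ₗ[ℝ] Y) {ε : ℝ} (hε : 0 ≤ ε)
    (h : ∀ v, |‖T v‖ - ‖S v‖| ≤ ε * ‖v‖) :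
    ∃ (D : Type u) (_ : NormedAddCommGroup D) (_ : NormedSpace ℝ D)
      (i : X →ₗᵢ[ℝ] D) (j : Y →ₗᵢ[ℝ] D), (∀ v, ‖i (T v) - j (S v)‖ ≤ ε * ‖v‖) ∧
        ∀ d, ∃ x y, d = i x + j y := by
  obtain ⟨D, _, _, π, hπ, hp⟩ := exists_normed_of_seminorm (amalgamSeminorm T S hε)
  refine ⟨D, _, _, ⟨π ∘ₗ LinearMap.inl ℝ X Y, fun x => ?_⟩, ⟨π ∘ₗ LinearMap.inr ℝ X Y, fun y => ?_⟩,
    fun v => ?_, fun d => ?_⟩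
  · rw [LinearMap.comp_apply, hp]
    refine le_antisymm ((amalgamSeminorm_le T S hε _ 0).trans (by simp))
      (le_amalgamSeminorm T S hε _ fun v => ?_)
    -- `‖x‖ ≤ ‖x - T v‖ + ‖T v‖` and `‖T v‖ ≤ ‖S v‖ + ε‖v‖`: near agreement of the norms is exactly
    -- what keeps the infimum from falling below `‖x‖`.
    have h1 := norm_sub_norm_le x (T v)
    have h2 := abs_le.1 (h v)
    simp only [LinearMap.inl_apply, zero_add]
    linarith [h2.2]
  · rw [LinearMap.comp_apply, hp]
    refine le_antisymm ((amalgamSeminorm_le T S hε _ 0).trans (by simp))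
      (le_amalgamSeminorm T S hε _ fun v => ?_)
    have h1 := norm_sub_norm_le y (-S v)
    have h2 := abs_le.1 (h v)
    simp only [LinearMap.inr_apply, zero_sub, norm_neg, sub_neg_eq_add] at h1 ⊢
    linarith [h2.1]
  · have : (π ∘ₗ LinearMap.inl ℝ X Y) (T v) - (π ∘ₗ LinearMap.inr ℝ X Y) (S v)
        = π (T v, -S v) := by
      rw [LinearMap.comp_apply, LinearMap.comp_apply, ← map_sub]; simp
    change ‖(π ∘ₗ LinearMap.inl ℝ X Y) (T v) - (π ∘ₗ LinearMap.inr ℝ X Y) (S v)‖ ≤ _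
    rw [this, hp]
    exact (amalgamSeminorm_le T S hε _ v).trans (by simp)
  · obtain ⟨⟨x, y⟩, rfl⟩ := hπ d
    refine ⟨x, y, ?_⟩
    change _ = (π ∘ₗ LinearMap.inl ℝ X Y) x + (π ∘ₗ LinearMap.inr ℝ X Y) y
    rw [LinearMap.comp_apply, LinearMap.comp_apply, ← map_add]; simp

/-- A space spanned by two finite-dimensional subspaces is finite-dimensional. -/
theorem finiteDimensional_of_forall_exists_add {X Y D : Type*} [NormedAddCommGroup X]
    [NormedSpace ℝ X] [NormedAddCommGroup Y] [NormedSpace ℝ Y] [NormedAddCommGroup D]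
    [NormedSpace ℝ D] [FiniteDimensional ℝ X] [FiniteDimensional ℝ Y] (i : X →ₗᵢ[ℝ] D)
    (j : Y →ₗᵢ[ℝ] D) (h : ∀ d, ∃ x y, d = i x + j y) : FiniteDimensional ℝ D :=
  Module.Finite.of_surjective (i.toLinearMap.coprod j.toLinearMap) fun d => by
    obtain ⟨x, y, rfl⟩ := h d
    exact ⟨(x, y), by simp⟩

/-! ### Banach spaces among the metric structures -/

section Operations

/-- The symbol for zero. -/
def symZero : banachLanguage.Functions 0 := BanachFunctions.zero

/-- The symbol for addition. -/
def symAdd : banachLanguage.Functions 2 := BanachFunctions.add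

/-- The symbol for multiplication by a scalar. -/
def symSMul (r : ℝ) : banachLanguage.Functions 1 := BanachFunctions.smul r

/-- The symbol for the norm. -/
def symNorm : banachLanguage.Relations 1 := BanachRelations.norm

variable (A : MetricStructure.{u} banachLanguage)

/-- The interpretation of zero. -/
def opZero : A := A.funMap symZero ![]

/-- The interpretation of addition. -/
def opAdd (x y : A) : A := A.funMap symAdd ![x, y]

/-- The interpretation of scalar multiplication. -/
def opSMul (r : ℝ) (x : A) : A := A.funMap (symSMul r) ![x]

/-- The interpretation of the norm. -/
def opNorm (x : A) : ℝ := A.relMap symNorm ![x]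

variable {A} {B : MetricStructure.{u} banachLanguage} (e : Embedding A B)

theorem Embedding.map_opZero : opZero B = e.toFun (opZero A) := by
  rw [opZero, opZero, ← e.map_fun]
  congr 1
  exact Subsingleton.elim _ _

theorem Embedding.map_opAdd (x y : A) :
    opAdd B (e.toFun x) (e.toFun y) = e.toFun (opAdd A x y) := by
  rw [opAdd, opAdd, ← e.map_fun]
  congr 1
  funext i
  fin_cases i <;> rfl

theorem Embedding.map_opSMul (r : ℝ) (x : A) :
    opSMul B r (e.toFun x) = e.toFun (opSMul A r x) := by
  rw [opSMul, opSMul, ← e.map_fun]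
  congr 1
  funext i
  fin_cases i; rfl

theorem Embedding.map_opNorm (x : A) : opNorm B (e.toFun x) = opNorm A x := by
  rw [opNorm, opNorm, ← e.map_rel]
  congr 1
  funext i
  fin_cases i; rfl

end Operations

section Normed

variable {X : Type u} [NormedAddCommGroup X] [NormedSpace ℝ X] [CompleteSpace X]
  {Y : Type u} [NormedAddCommGroup Y] [NormedSpace ℝ Y] [CompleteSpace Y]
  {A : MetricStructure.{u} banachLanguage}

theorem Embedding.injective {L : FirstOrder.Language.{0, 0}} {A B : MetricStructure.{u} L}
    (e : Embedding A B) : Function.Injective e.toFun :=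
  (Isometry.of_dist_eq e.dist_eq).injective

/-- A map respecting the operations and the distance is an embedding. -/
def embeddingOfOps {A B : MetricStructure.{u} banachLanguage} (e : A → B)
    (h0 : opZero B = e (opZero A)) (ha : ∀ x y, opAdd B (e x) (e y) = e (opAdd A x y))
    (hs : ∀ (r : ℝ) x, opSMul B r (e x) = e (opSMul A r x)) (hn : ∀ x, opNorm B (e x) = opNorm A x)
    (hd : ∀ x y, dist (e x) (e y) = dist x y) : Embedding A B where
  toFun := e
  dist_eq := hd
  map_rel R a := by
    cases R
    convert hn (a 0) using 1
    · rw [opNorm]; congr 1; funext i; fin_cases i; rfl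
    · rw [opNorm]; congr 1; funext i; fin_cases i; rfl
  map_fun f a := by
    cases f with
    | zero =>
      convert h0 using 1
      · rw [opZero]; congr 1; exact Subsingleton.elim _ _
      · rw [opZero]; congr 2; exact Subsingleton.elim _ _
    | add =>
      convert ha (a 0) (a 1) using 1
      · rw [opAdd]; congr 1; funext i; fin_cases i <;> rfl
      · rw [opAdd]; congr 2; funext i; fin_cases i <;> rfl
    | smul r =>
      convert hs r (a 0) using 1
      · rw [opSMul]; congr 1; funext i; fin_cases i; rfl
      · rw [opSMul]; congr 2; funext i; fin_cases i; rfl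

/-- Embeddings of Banach spaces are linear isometries. -/
def Embedding.toLinearIsometry (e : Embedding (banachStructure X) (banachStructure Y)) :
    X →ₗᵢ[ℝ] Y where
  toFun := e.toFun
  map_add' x y := (e.map_opAdd x y).symm
  map_smul' r x := (e.map_opSMul r x).symm
  norm_map' x := e.map_opNorm x

/-- Linear isometries are embeddings. -/
noncomputable def embeddingOfLinearIsometry (f : X →ₗᵢ[ℝ] Y) :
    Embedding (banachStructure X) (banachStructure Y) :=
  embeddingOfOps (A := banachStructure X) (B := banachStructure Y) f
    f.map_zero.symm (fun x y => (f.map_add x y).symm) (fun r x => (f.map_smul r x).symm) f.norm_map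
      f.dist_map

/-- The continuity fields are propositions, so over a fixed carrier and metric only the
interpretations of the symbols have to be compared. -/
theorem MetricStructure.mk_congr {L : FirstOrder.Language.{0, 0}} {C : Type u} (m : MetricSpace C)
    (h : CompleteSpace C) {r r' : ∀ {n : ℕ}, L.Relations n → (Fin n → C) → ℝ}
    {f f' : ∀ {n : ℕ}, L.Functions n → (Fin n → C) → C} (hr : @r = @r') (hf : @f = @f')
    (cr : ∀ {n : ℕ} (R : L.Relations n), Continuous (@r n R))
    (cf : ∀ {n : ℕ} (g : L.Functions n), Continuous (@f n g))
    (cr' : ∀ {n : ℕ} (R : L.Relations n), Continuous (@r' n R))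
    (cf' : ∀ {n : ℕ} (g : L.Functions n), Continuous (@f' n g)) :
    (⟨C, r, f, cr, cf⟩ : MetricStructure.{u} L) = ⟨C, r', f', cr', cf'⟩ := by
  subst hr hf; rfl

/-- A structure all of whose finite subsets are covered by embedded Banach spaces is the
structure of a Banach space. -/
theorem eq_banachStructure_of_forall_finite (A : MetricStructure.{u} banachLanguage)
    (h : ∀ S : Set A, S.Finite → ∃ (X : Type u) (_ : NormedAddCommGroup X) (_ : NormedSpace ℝ X)
      (_ : CompleteSpace X) (e : Embedding (banachStructure X) A), S ⊆ range e.toFun) :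
    ∃ (X : Type u) (_ : NormedAddCommGroup X) (_ : NormedSpace ℝ X) (_ : CompleteSpace X),
      A = banachStructure X := by
  let iz : Zero A := ⟨opZero A⟩
  let ia : Add A := ⟨opAdd A⟩
  let is : SMul ℝ A := ⟨opSMul A⟩
  let ing : Neg A := ⟨opSMul A (-1)⟩
  let inn : Norm A := ⟨opNorm A⟩
  -- Each axiom of a normed space involves at most three vectors, and any three elements lie in one
  -- embedded Banach space, where the axiom holds.
  have h3 : ∀ x y z : A, ∃ (X : Type u) (_ : NormedAddCommGroup X) (_ : NormedSpace ℝ X)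
      (e : X → A), 0 = e 0 ∧ (∀ x y, e x + e y = e (x + y)) ∧ (∀ (r : ℝ) x, r • e x = e (r • x)) ∧
      (∀ x, - e x = e (- x)) ∧ (∀ x, ‖e x‖ = ‖x‖) ∧ (∀ x y, dist (e x) (e y) = dist x y) ∧
      ∃ x' y' z' : X, e x' = x ∧ e y' = y ∧ e z' = z := by
    intro x y z
    obtain ⟨X, i1, i2, i3, e, he⟩ := h {x, y, z} (by simp)
    obtain ⟨x', hx⟩ := he (show x ∈ ({x, y, z} : Set A) by simp)
    obtain ⟨y', hy⟩ := he (show y ∈ ({x, y, z} : Set A) by simp)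
    obtain ⟨z', hz⟩ := he (show z ∈ ({x, y, z} : Set A) by simp)
    exact ⟨X, i1, i2, e.toFun, e.map_opZero, e.map_opAdd, e.map_opSMul, fun x =>
      (e.map_opSMul (-1) x).trans (congrArg e.toFun (neg_one_smul ℝ (x : X))), e.map_opNorm,
      e.dist_eq, x', y', z', hx, hy, hz⟩
  let n1 : NormedAddCommGroup A :=
    -- The given metric is kept, so that the final equality of structures only concerns the symbols.
    { A.metric, iz, ia, ing, inn with
      add_assoc := fun x y z => by
        obtain ⟨X, i1, i2, e, ez, ea, es, en, eo, ed, x, y, z, rfl, rfl, rfl⟩ := h3 x y z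
        rw [ea, ea, ea, ea, add_assoc]
      zero_add := fun x => by
        obtain ⟨X, i1, i2, e, ez, ea, es, en, eo, ed, x, y, z, rfl, -, -⟩ := h3 x x x
        rw [ez, ea, zero_add]
      add_zero := fun x => by
        obtain ⟨X, i1, i2, e, ez, ea, es, en, eo, ed, x, y, z, rfl, -, -⟩ := h3 x x x
        rw [ez, ea, add_zero]
      nsmul := nsmulRec
      zsmul := zsmulRec
      neg_add_cancel := fun x => by
        obtain ⟨X, i1, i2, e, ez, ea, es, en, eo, ed, x, y, z, rfl, -, -⟩ := h3 x x x
        rw [ez, en, ea, neg_add_cancel]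
      add_comm := fun x y => by
        obtain ⟨X, i1, i2, e, ez, ea, es, en, eo, ed, x, y, z, rfl, rfl, -⟩ := h3 x y y
        rw [ea, ea, add_comm]
      dist_eq := fun x y => by
        obtain ⟨X, i1, i2, e, ez, ea, es, en, eo, ed, x, y, z, rfl, rfl, -⟩ := h3 x y y
        rw [en, ea, eo, ed]
        exact NormedAddGroup.dist_eq _ _ }
  let n2 : NormedSpace ℝ A :=
    { is with
      one_smul := fun x => by
        obtain ⟨X, i1, i2, e, ez, ea, es, en, eo, ed, x, y, z, rfl, -, -⟩ := h3 x x x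
        rw [es, one_smul]
      mul_smul := fun r s x => by
        obtain ⟨X, i1, i2, e, ez, ea, es, en, eo, ed, x, y, z, rfl, -, -⟩ := h3 x x x
        rw [es, es, es, mul_smul]
      smul_zero := fun r => by
        obtain ⟨X, i1, i2, e, ez, ea, es, en, eo, ed, -⟩ := h3 0 0 0
        change r • (0 : A) = (0 : A)
        have := es r 0
        rwa [smul_zero, ← ez] at this
      smul_add := fun r x y => by
        obtain ⟨X, i1, i2, e, ez, ea, es, en, eo, ed, x, y, z, rfl, rfl, -⟩ := h3 x y y
        change r • (e x + e y : A) = r • e x + r • e y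
        rw [ea, es, es, es, ea, smul_add]
      add_smul := fun r s x => by
        obtain ⟨X, i1, i2, e, ez, ea, es, en, eo, ed, x, y, z, rfl, -, -⟩ := h3 x x x
        change (r + s) • e x = r • e x + s • e x
        rw [es, es, es, ea, add_smul]
      zero_smul := fun x => by
        obtain ⟨X, i1, i2, e, ez, ea, es, en, eo, ed, x, y, z, rfl, -, -⟩ := h3 x x x
        change (0 : ℝ) • e x = (0 : A)
        rw [es, ez, zero_smul]
      norm_smul_le := fun r x => by
        obtain ⟨X, i1, i2, e, ez, ea, es, en, eo, ed, x, y, z, rfl, -, -⟩ := h3 x x x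
        change ‖r • e x‖ ≤ ‖r‖ * ‖e x‖
        rw [es, eo, eo, norm_smul] }
  refine ⟨A, n1, n2, A.complete, ?_⟩
  have hf : ∀ (n : ℕ) (f : banachLanguage.Functions n),
      A.funMap f = banachFunMap A f := by
    intro n f
    funext v
    cases f with
    | zero => exact congrArg (A.funMap symZero) (Subsingleton.elim _ _)
    | add => exact congrArg (A.funMap symAdd) (by funext i; fin_cases i <;> rfl)
    | smul r => exact congrArg (A.funMap (symSMul r)) (by funext i; fin_cases i; rfl)
  have hr : ∀ (n : ℕ) (R : banachLanguage.Relations n),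
      A.relMap R = banachRelMap A R := by
    intro n R
    funext v
    cases R
    exact congrArg (A.relMap symNorm) (by funext i; fin_cases i; rfl)
  have hf' : @MetricStructure.funMap banachLanguage A = @banachFunMap A n1 n2 := by
    funext n f; exact hf n f
  have hr' : @MetricStructure.relMap banachLanguage A = @banachRelMap A n1 := by
    funext n R; exact hr n R
  exact MetricStructure.mk_congr A.metric A.complete hr' hf' A.continuous_relMap
    A.continuous_funMap (banachStructure A).continuous_relMap (banachStructure A).continuous_funMap

/-! ### Substructures, finite generation and the age of a Banach space -/

theorem isSubstructure_submodule (V : Submodule ℝ X) (hV : IsClosed (V : Set X)) :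
    IsSubstructure (banachStructure X) (V : Set X) := by
  refine ⟨hV, fun f a ha => ?_⟩
  cases f with
  | zero => exact V.zero_mem
  | add => exact V.add_mem (ha 0) (ha 1)
  | smul r => exact V.smul_mem r (ha 0)

/-- The substructure of a Banach space generated by a set. -/
def banachGenerated (S : Set X) : Set X := generatedSet (banachStructure X) S

theorem banachGenerated_subset_submodule {S : Set X} (V : Submodule ℝ X)
    (hV : IsClosed (V : Set X)) (h : S ⊆ V) : banachGenerated S ⊆ V :=
  fun _ hx => hx _ ⟨isSubstructure_submodule V hV, h⟩

/-- A substructure of a Banach space, as a submodule. -/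
def IsSubstructure.toSubmodule {S : Set X} (h : IsSubstructure (banachStructure X) S) :
    Submodule ℝ X where
  carrier := S
  zero_mem' := h.2 symZero ![] (fun i => i.elim0)
  add_mem' {x y} hx hy := h.2 symAdd ![x, y] (fun i => by fin_cases i <;> assumption)
  smul_mem' r x hx := h.2 (symSMul r) ![x] (fun i => by fin_cases i; assumption)

theorem span_subset_banachGenerated (S : Set X) :
    (Submodule.span ℝ S : Set X) ⊆ banachGenerated S :=
  Submodule.span_le (p := IsSubstructure.toSubmodule (S := banachGenerated S)
    (isSubstructure_generatedSet (banachStructure X) S)).2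
    (subset_generatedSet (banachStructure X) S)

/-- Finite-dimensional subspaces are closed, so no limits have to be added to the linear span. -/
theorem banachGenerated_eq_span {S : Set X} (hS : S.Finite) :
    banachGenerated S = Submodule.span ℝ S :=
  have := FiniteDimensional.span_of_finite ℝ hS
  (banachGenerated_subset_submodule _ (Submodule.closed_of_finiteDimensional _)
    Submodule.subset_span).antisymm (span_subset_banachGenerated S)

theorem isFG_banachStructure_iff :
    IsFG (banachStructure X) ↔ FiniteDimensional ℝ X := by
  constructor
  · rintro ⟨S, hS, h⟩
    have h' := (banachGenerated_eq_span (X := X) hS).symm.trans h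
    exact ⟨Submodule.fg_def.2 ⟨S, hS, SetLike.coe_injective h'⟩⟩
  · rintro ⟨h⟩
    obtain ⟨S, hS, h⟩ := Submodule.fg_def.1 h
    exact ⟨S, hS, (banachGenerated_eq_span (X := X) hS).trans (congrArg SetLike.coe h)⟩

/-- The composition of embeddings. -/
def Embedding.trans {L : FirstOrder.Language.{0, 0}} {A B C : MetricStructure.{u} L}
    (e : Embedding A B) (f : Embedding B C) : Embedding A C where
  toFun := f.toFun ∘ e.toFun
  dist_eq _ _ := (f.dist_eq _ _).trans (e.dist_eq _ _)
  map_rel R a := (f.map_rel R _).trans (e.map_rel R a)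
  map_fun g a := (f.map_fun g _).trans (congrArg f.toFun (e.map_fun g a))

/-- One surjective embedding covers all finite subsets at once, so membership up to isomorphism
upgrades to an equality that can be substituted. -/
theorem mem_finDimBanach_iff : A ∈ finDimBanach ↔ ∃ (X : Type u) (_ : NormedAddCommGroup X)
    (_ : NormedSpace ℝ X) (_ : CompleteSpace X), FiniteDimensional ℝ X ∧ A = banachStructure X := by
  constructor
  · rintro ⟨X, i1, i2, i3, i4, e, he⟩
    obtain ⟨Y, j1, j2, j3, rfl⟩ := eq_banachStructure_of_forall_finite A fun S _ =>
      ⟨X, i1, i2, i3, e, fun x _ => he x⟩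
    exact ⟨Y, j1, j2, j3, Module.Finite.of_surjective e.toLinearIsometry.toLinearMap he, rfl⟩
  · rintro ⟨X, i1, i2, i3, i4, rfl⟩
    exact ⟨X, i1, i2, i3, i4, embeddingOfLinearIsometry LinearIsometry.id,
      Function.surjective_id⟩

theorem banachStructure_mem [FiniteDimensional ℝ X] : banachStructure X ∈ finDimBanach.{u} :=
  mem_finDimBanach_iff.2 ⟨X, _, _, inferInstance, inferInstance, rfl⟩

/-- If `A` is generated by a finite `S` and `e` embeds it in `X`, then `e` maps onto the span `E` of
`e '' S`. The preimage of `E` is a substructure containing `S`, hence everything; and the range of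
`e`, being complete and stable under the operations, is a submodule containing `e '' S`. -/
theorem isKStructure_banachStructure (X : Type u) [NormedAddCommGroup X] [NormedSpace ℝ X]
    [CompleteSpace X] : IsKStructure finDimBanach (banachStructure X) := by
  rintro A ⟨⟨S, hS, hA⟩, ⟨e⟩⟩
  let E : Submodule ℝ X := Submodule.span ℝ (e.toFun '' S)
  have hE : FiniteDimensional ℝ E := FiniteDimensional.span_of_finite ℝ (hS.image _)
  have hsub : IsSubstructure A (e.toFun ⁻¹' (E : Set X)) := by
    have h := isSubstructure_submodule E E.closed_of_finiteDimensional
    refine ⟨h.1.preimage (Isometry.of_dist_eq e.dist_eq).continuous, fun f a ha => ?_⟩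
    have := h.2 f (fun i => e.toFun (a i)) ha
    rwa [e.map_fun] at this
  have h1 : ∀ a, e.toFun a ∈ (E : Set X) := fun a =>
    (hA.symm ▸ mem_univ a : a ∈ generatedSet A S) _
      ⟨hsub, fun s hs => Submodule.subset_span (mem_image_of_mem _ hs)⟩
  let R : Submodule ℝ X := IsSubstructure.toSubmodule (S := range e.toFun)
    ⟨(Isometry.of_dist_eq e.dist_eq).isClosedEmbedding.isClosed_range, fun f a ha => by
      choose b hb using ha
      exact ⟨A.funMap f b, by
        rw [← e.map_fun]; exact congrArg ((banachStructure X).funMap f) (funext hb)⟩⟩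
  let inc : Embedding (banachStructure E) (banachStructure X) :=
    embeddingOfLinearIsometry E.subtypeₗᵢ
  have h2 : ∀ x : banachStructure E, ∃ a, e.toFun a = inc.toFun x := fun x =>
    Submodule.span_le (p := R).2 (image_subset_range _ _) (Subtype.property (p := (· ∈ E)) x)
  choose g hg using h2
  refine ⟨E, inferInstance, inferInstance, inferInstance, hE,
    embeddingOfOps (A := banachStructure E) g (e.injective ?_) (fun x y => e.injective ?_)
      (fun r x => e.injective ?_) (fun x => ?_) (fun x y => ?_), fun a => ⟨⟨e.toFun a, h1 a⟩,
        e.injective (hg _)⟩⟩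
  · rw [hg, ← e.map_opZero, inc.map_opZero]
  · rw [hg, ← e.map_opAdd, hg, hg, inc.map_opAdd]
  · rw [hg, ← e.map_opSMul, hg, inc.map_opSMul]
  · rw [← e.map_opNorm, hg, inc.map_opNorm]
  · rw [← e.dist_eq, hg, hg, inc.dist_eq]

/-- Every finite subset generates a member of the age, that is, a finite-dimensional space; these
local linear structures agree since they come from the symbols. -/
theorem isKStructure_iff : IsKStructure finDimBanach A ↔ ∃ (X : Type u) (_ : NormedAddCommGroup X)
    (_ : NormedSpace ℝ X) (_ : CompleteSpace X), A = banachStructure X := by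
  constructor
  · intro h
    refine eq_banachStructure_of_forall_finite A fun S hS => ?_
    have : generated A S ∈ finDimBanach := h
      ⟨⟨(fun a : generated A S => Subtype.val (p := (· ∈ generatedSet A S)) a) ⁻¹' S, ?_, ?_⟩,
      ⟨⟨Subtype.val, fun _ _ => rfl, fun _ _ => rfl, fun _ _ => rfl⟩⟩⟩
    · obtain ⟨X, i1, i2, i3, -, e, he⟩ := this
      refine ⟨X, i1, i2, i3, e.trans (⟨Subtype.val, fun _ _ => rfl, fun _ _ => rfl,
        fun _ _ => rfl⟩ : Embedding (generated A S) A), fun s hs => ?_⟩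
      obtain ⟨x, hx⟩ := he (toGenerated A ⟨s, hs⟩)
      exact ⟨x, congrArg Subtype.val hx⟩
    · exact hS.preimage Subtype.val_injective.injOn
    · refine eq_univ_of_forall fun a => ?_
      rintro T ⟨⟨hT1, hT2⟩, hT3⟩
      have hcl : IsClosed (generatedSet A S) := (isSubstructure_generatedSet A S).1
      have := a.2 (Subtype.val '' T) ⟨⟨hcl.isClosedEmbedding_subtypeVal.isClosedMap _ hT1,
        fun f b hb => ?_⟩, fun s hs => ⟨toGenerated A ⟨s, hs⟩, hT3 hs, rfl⟩⟩
      · obtain ⟨b, hb, hba⟩ := this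
        rwa [← Subtype.ext hba]
      · choose c hc hcb using hb
        exact ⟨_, hT2 f c hc, congrArg (A.funMap f) (funext hcb)⟩
  · rintro ⟨X, i1, i2, i3, rfl⟩
    exact isKStructure_banachStructure X

/-! ### Finite partial isomorphisms as linear isometries -/

/-- The finite partial isomorphism obtained by restricting a linear isometry. -/
theorem exists_finitePartialIso {S : Set X} (hS : S.Finite) (V : Submodule ℝ X)
    (hV : IsClosed (V : Set X)) (hSV : S ⊆ V) (T : V →ₗᵢ[ℝ] Y) :
    ∃ f : FinitePartialIso (banachStructure X) (banachStructure Y), ∃ h : f.dom = S,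
      ∀ (a : X) (ha : a ∈ S), f.toFun ⟨a, h.symm ▸ ha⟩ = T ⟨a, hSV ha⟩ := by
  have h := banachGenerated_subset_submodule V hV hSV
  refine ⟨⟨S, hS, fun a => T ⟨a.1, hSV a.2⟩, embeddingOfOps
    (A := generated (banachStructure X) S) (B := banachStructure Y)
    (fun a => T ⟨a.1, h a.2⟩) T.map_zero.symm ?_ ?_ ?_ ?_, fun a => rfl⟩, rfl, fun a _ => rfl⟩
  · exact fun x y => (T.map_add _ _).symm
  · exact fun r x => (T.map_smul r _).symm
  · exact fun x => T.norm_map _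
  · exact fun x y => T.dist_map _ _

/-- The domain of a finite partial isomorphism between Banach spaces. -/
def FinitePartialIso.domain (f : FinitePartialIso (banachStructure X) A) : Set X := f.dom

/-- A finite partial isomorphism extends to a linear isometry on the span of its domain. -/
theorem FinitePartialIso.exists_linearIsometry
    (f : FinitePartialIso (banachStructure X) (banachStructure Y)) :
    ∃ T : Submodule.span ℝ f.domain →ₗᵢ[ℝ] Y,
      ∀ (a : X) (ha : a ∈ f.domain), T ⟨a, Submodule.subset_span ha⟩ = f.toFun ⟨a, ha⟩ := by
  obtain ⟨F, hF⟩ := f.extends_to_embedding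
  have h := span_subset_banachGenerated f.domain
  refine ⟨⟨⟨⟨fun x => F.toFun (⟨(x : X), h x.2⟩ : banachGenerated f.domain), fun x y => ?_⟩,
    fun r x => ?_⟩, fun x => ?_⟩,
    fun a ha => hF ⟨a, ha⟩⟩
  · exact (F.map_opAdd (⟨(x : X), h x.2⟩ : banachGenerated f.domain)
      (⟨(y : X), h y.2⟩ : banachGenerated f.domain)).symm
  · exact (F.map_opSMul r (⟨(x : X), h x.2⟩ : banachGenerated f.domain)).symm
  · exact F.map_opNorm (⟨(x : X), h x.2⟩ : banachGenerated f.domain)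

end Normed

/-! ### Approximate isometries and joint embeddings -/

theorem edist_le_comp {X Y Z D : Type*} [MetricSpace D] {i : X → D} {j : Z → D}
    {c : Y → D} {ψ : X → Y → ℝ≥0∞} {φ : Y → Z → ℝ≥0∞}
    (hψ : ∀ x y, edist (i x) (c y) ≤ ψ x y) (hφ : ∀ y z, edist (c y) (j z) ≤ φ y z) (x : X)
    (z : Z) :
    edist (i x) (j z) ≤ comp φ ψ x z :=
  le_iInf fun y => (edist_triangle _ (c y) _).trans (add_le_add (hψ x y) (hφ y z))

/-! ### Relaxations on finite sets and the strict order -/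

section Approx

variable {X Y D : Type*} [MetricSpace X] [MetricSpace Y] [MetricSpace D]

/-- The lower Katětov bound is inherited from any smaller approximate isometry, so only the two
Lipschitz conditions remain to be checked. -/
theorem isApproxIsometry_of_le {δ ρ : X → Y → ℝ≥0∞} (hδ : IsApproxIsometry δ)
    (h : ∀ x y, δ x y ≤ ρ x y) (hx : ∀ x x' y, ρ x y ≤ edist x x' + ρ x' y)
    (hy : ∀ x y y', ρ x y ≤ ρ x y' + edist y' y) : IsApproxIsometry ρ :=
  ⟨fun y x x' => ⟨hx x x' y, ((hδ.1 y x x').2).trans (add_le_add (h _ _) (h _ _))⟩,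
    fun x y y' => ⟨(hy x y y').trans (by rw [add_comm, edist_comm]),
      ((hδ.2 x y y').2).trans (add_le_add (h _ _) (h _ _))⟩⟩

theorem IsApproxIsometry.le_add {ψ : X → Y → ℝ≥0∞} (h : IsApproxIsometry ψ) (x x' : X) (y y' : Y) :
    ψ x y ≤ edist x x' + ψ x' y' + edist y' y := by
  refine ((h.1 y x x').1).trans ?_
  rw [add_assoc]
  refine add_le_add le_rfl (((h.2 x' y y').1).trans ?_)
  rw [add_comm, edist_comm]

theorem isApproxIsometry_edist {i : X → D} {j : Y → D} (hi : Isometry i) (hj : Isometry j) :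
    IsApproxIsometry fun x y => edist (i x) (j y) := by
  refine ⟨fun y x x' => ⟨?_, ?_⟩, fun x y y' => ⟨?_, ?_⟩⟩
  · rw [← hi.edist_eq]; exact edist_triangle _ _ _
  · rw [← hi.edist_eq]; exact edist_triangle_right _ _ _
  · rw [← hj.edist_eq, add_comm, edist_comm (j y)]; exact edist_triangle _ _ _
  · rw [← hj.edist_eq]; exact edist_triangle_left _ _ _

theorem edist_le_ofPartialMap {i : X → D} {j : Y → D} (hi : Isometry i) (hj : Isometry j)
    {S : Set X} {f : S → Y} (h : ∀ a : S, i a = j (f a)) (x : X) (y : Y) :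
    edist (i x) (j y) ≤ ofPartialMap f x y :=
  le_iInf fun a => by
    rw [← hi.edist_eq x a, ← hj.edist_eq, h a]
    exact edist_triangle _ _ _

theorem ofPartialMap_le_add_left {S : Set X} (f : S → Y) (x x' : X) (y : Y) :
    ofPartialMap f x y ≤ edist x x' + ofPartialMap f x' y := by
  rw [ofPartialMap, ofPartialMap, ENNReal.add_iInf]
  refine iInf_mono fun a => ?_
  rw [← add_assoc]
  exact add_le_add (edist_triangle _ _ _) le_rfl

theorem ofPartialMap_le_add_right {S : Set X} (f : S → Y) (x : X) (y y' : Y) :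
    ofPartialMap f x y ≤ ofPartialMap f x y' + edist y' y := by
  rw [ofPartialMap, ofPartialMap, ENNReal.iInf_add]
  refine iInf_mono fun a => ?_
  rw [add_assoc]
  exact add_le_add le_rfl (edist_triangle _ _ _)

theorem comp_le_add_left {X Y Z : Type*} [MetricSpace X] {ψ : X → Z → ℝ≥0∞}
    (h : ∀ x x' z, ψ x z ≤ edist x x' + ψ x' z) (φ : Z → Y → ℝ≥0∞) (x x' : X) (y : Y) :
    comp φ ψ x y ≤ edist x x' + comp φ ψ x' y := by
  rw [comp, comp, ENNReal.add_iInf]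
  refine iInf_mono fun z => ?_
  rw [← add_assoc]
  exact add_le_add (h _ _ _) le_rfl

theorem comp_le_add_right {X Y Z : Type*} [MetricSpace Y] {φ : Z → Y → ℝ≥0∞}
    (h : ∀ z y y', φ z y ≤ φ z y' + edist y' y) (ψ : X → Z → ℝ≥0∞) (x : X) (y y' : Y) :
    comp φ ψ x y ≤ comp φ ψ x y' + edist y' y := by
  rw [comp, comp, ENNReal.iInf_add]
  refine iInf_mono fun z => ?_
  rw [add_assoc]
  exact add_le_add le_rfl (h _ _ _)

/-- The least approximate isometry below the function `c` on the set `S`. -/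
noncomputable def spread (S : Set (X × Y)) (c : X → Y → ℝ≥0∞) : X → Y → ℝ≥0∞ :=
  fun x y => ⨅ k ∈ S, edist x k.1 + c k.1 k.2 + edist k.2 y

theorem spread_le {S : Set (X × Y)} (c : X → Y → ℝ≥0∞) {k : X × Y} (hk : k ∈ S) :
    spread S c k.1 k.2 ≤ c k.1 k.2 :=
  (iInf₂_le k hk).trans (by simp)

/-- With `spread_le`, this makes the spread the greatest approximate isometry bounded by `c` on `S`,
as soon as there is one. -/
theorem le_spread {S : Set (X × Y)} {c ψ : X → Y → ℝ≥0∞} (hψ : IsApproxIsometry ψ)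
    (h : ∀ k ∈ S, ψ k.1 k.2 ≤ c k.1 k.2) (x : X) (y : Y) : ψ x y ≤ spread S c x y :=
  le_iInf₂ fun k hk => (hψ.le_add x k.1 y k.2).trans
    (add_le_add (add_le_add le_rfl (h k hk)) le_rfl)

theorem spread_mono {S : Set (X × Y)} {c c' : X → Y → ℝ≥0∞}
    (h : ∀ k ∈ S, c k.1 k.2 ≤ c' k.1 k.2) (x : X) (y : Y) : spread S c x y ≤ spread S c' x y :=
  iInf₂_mono fun k hk => add_le_add (add_le_add le_rfl (h k hk)) le_rfl

theorem isApproxIsometry_spread (S : Set (X × Y)) {c ψ : X → Y → ℝ≥0∞} (hψ : IsApproxIsometry ψ)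
    (h : ∀ k ∈ S, ψ k.1 k.2 ≤ c k.1 k.2) : IsApproxIsometry (spread S c) := by
  refine isApproxIsometry_of_le hψ (le_spread hψ h) (fun x x' y => ?_) (fun x y y' => ?_)
  · simp only [spread, ENNReal.add_iInf]
    refine iInf₂_mono fun k _ => ?_
    rw [← add_assoc, ← add_assoc]
    exact add_le_add (add_le_add (edist_triangle _ _ _) le_rfl) le_rfl
  · simp only [spread, ENNReal.iInf_add]
    refine iInf₂_mono fun k _ => ?_
    rw [add_assoc _ (edist k.2 y')]
    exact add_le_add le_rfl (edist_triangle _ _ _)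

theorem Apx.le_iff {φ ψ : Apx X Y} : φ ≤ ψ ↔ ∀ x y, φ.1 x y ≤ ψ.1 x y := Iff.rfl

/-- `φ + ε` on `S`, trivially extended. -/
noncomputable def relax (φ : Apx X Y) (S : Set (X × Y)) (ε : ℝ≥0∞) : Apx X Y :=
  ⟨spread S fun x y => φ.1 x y + ε, isApproxIsometry_spread S φ.2 fun _ _ => le_self_add⟩

theorem relax_apply (φ : Apx X Y) (S : Set (X × Y)) (ε : ℝ≥0∞) (x : X) (y : Y) :
    (relax φ S ε).1 x y = spread S (fun x y => φ.1 x y + ε) x y := rfl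

theorem le_relax (φ : Apx X Y) (S : Set (X × Y)) (ε : ℝ≥0∞) : φ ≤ relax φ S ε :=
  Apx.le_iff.2 fun x y => by
    rw [relax_apply]
    exact le_spread φ.2 (fun _ _ => le_self_add) x y

theorem relax_le (φ : Apx X Y) {S : Set (X × Y)} (ε : ℝ≥0∞) {x : X} {y : Y} (h : (x, y) ∈ S) :
    (relax φ S ε).1 x y ≤ φ.1 x y + ε := by
  rw [relax_apply]
  have := spread_le (k := (x, y)) (fun x y => φ.1 x y + ε) h
  exact this

theorem relax_mono {φ ψ : Apx X Y} (h : φ ≤ ψ) (S : Set (X × Y)) (ε : ℝ≥0∞) :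
    relax φ S ε ≤ relax ψ S ε :=
  Apx.le_iff.2 fun x y => by
    rw [relax_apply, relax_apply]
    have h' : ∀ k ∈ S, φ.1 k.1 k.2 + ε ≤ ψ.1 k.1 k.2 + ε := fun k _ =>
      add_le_add (Apx.le_iff.1 h k.1 k.2) le_rfl
    exact spread_mono h' x y

theorem relax_le_relax {φ ψ : Apx X Y} {S : Set (X × Y)} {ε ε' : ℝ≥0∞}
    (h : ∀ k ∈ S, φ.1 k.1 k.2 + ε ≤ ψ.1 k.1 k.2 + ε') : relax φ S ε ≤ relax ψ S ε' :=
  Apx.le_iff.2 fun x y => by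
    rw [relax_apply, relax_apply]
    exact spread_mono h x y

/-- `relax φ S ε` tends to `φ` as the finite set `S` grows and `ε` decreases to `0`, so it
eventually enters the neighbourhood of `φ` lying below `ψ`. -/
theorem StrictlyRefines.exists_relax_le {φ ψ : Apx X Y} (h : StrictlyRefines φ ψ) :
    ∃ S : Set (X × Y), S.Finite ∧ ∃ ε : ℝ≥0∞, 0 < ε ∧ ε < ∞ ∧ relax φ S ε ≤ ψ := by
  have ht : Filter.Tendsto (fun p : Finset (X × Y) × ℝ≥0∞ => relax φ (p.1 : Set (X × Y)) p.2)
      (Filter.atTop ×ˢ 𝓝[>] 0) (𝓝 φ) := by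
    rw [tendsto_subtype_rng, tendsto_pi_nhds]
    intro x
    rw [tendsto_pi_nhds]
    intro y
    have h2 : Filter.Tendsto (fun p : Finset (X × Y) × ℝ≥0∞ => φ.1 x y + p.2)
        (Filter.atTop ×ˢ 𝓝[>] 0) (𝓝 (φ.1 x y)) := by
      have h3 : Filter.Tendsto (fun p : Finset (X × Y) × ℝ≥0∞ => p.2)
        (Filter.atTop ×ˢ 𝓝[>] 0) (𝓝 0) := Filter.tendsto_snd.mono_right nhdsWithin_le_nhds
      simpa using h3.const_add (φ.1 x y)
    refine tendsto_of_tendsto_of_tendsto_of_le_of_le' tendsto_const_nhds h2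
      (Filter.Eventually.of_forall fun p => le_relax φ _ _ x y) ?_
    have := (Filter.eventually_ge_atTop ({(x, y)} : Finset (X × Y))).prod_inl
      (𝓝[>] (0 : ℝ≥0∞))
    filter_upwards [this] with p hp
    exact relax_le φ _ (hp (by simp))
  have h1 : ∀ᶠ p : Finset (X × Y) × ℝ≥0∞ in Filter.atTop ×ˢ 𝓝[>] 0,
      relax φ (p.1 : Set (X × Y)) p.2 ≤ ψ := ht (mem_interior_iff_mem_nhds.1 h)
  have h2 : ∀ᶠ p : Finset (X × Y) × ℝ≥0∞ in Filter.atTop ×ˢ 𝓝[>] 0, 0 < p.2 ∧ p.2 < ∞ :=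
    Filter.Eventually.prod_inr
      ((eventually_mem_nhdsWithin).and (nhdsWithin_le_nhds (Iio_mem_nhds ENNReal.zero_lt_top))) _
  obtain ⟨p, hp1, hp2, hp3⟩ := (Filter.Eventually.and h1 h2).exists
  exact ⟨p.1, p.1.finite_toSet, p.2, hp2, hp3, hp1⟩

/-- The conditions `ρ < φ + ε` at the finitely many points of `S` define an open set below the
relaxation. Finiteness of the values is needed for `φ < φ + ε`. -/
theorem strictlyRefines_relax {φ : Apx X Y} (hφ : ∀ x y, φ.1 x y < ∞) {S : Set (X × Y)}
    (hS : S.Finite) {ε : ℝ≥0∞} (hε : 0 < ε) : StrictlyRefines φ (relax φ S ε) := by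
  have hopen : IsOpen (⋂ k ∈ S, {ρ : Apx X Y | ρ.1 k.1 k.2 < φ.1 k.1 k.2 + ε}) :=
    hS.isOpen_biInter fun k _ => isOpen_lt
      ((continuous_apply k.2).comp ((continuous_apply k.1).comp continuous_subtype_val))
      continuous_const
  refine mem_interior.2 ⟨_, fun ρ hρ => ?_, hopen, ?_⟩
  · refine Apx.le_iff.2 fun x y => ?_
    rw [relax_apply]
    refine le_spread ρ.2 (fun k hk => ?_) x y
    have : ρ.1 k.1 k.2 < φ.1 k.1 k.2 + ε := mem_iInter₂.1 hρ k hk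
    exact this.le
  · exact mem_iInter₂.2 fun k _ => ENNReal.lt_add_right (hφ _ _).ne hε.ne'

theorem Apx.tendsto_of_eq {φ : Finset (X × Y) → Apx X Y} {ψ : Apx X Y}
    (h : ∀ S, ∀ k ∈ S, (φ S).1 k.1 k.2 = ψ.1 k.1 k.2) : Filter.Tendsto φ Filter.atTop (𝓝 ψ) := by
  rw [tendsto_subtype_rng, tendsto_pi_nhds]
  intro x
  rw [tendsto_pi_nhds]
  intro y
  refine tendsto_const_nhds.congr' ?_
  filter_upwards [Filter.eventually_ge_atTop ({(x, y)} : Finset (X × Y))] with S hS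
  exact (h S (x, y) (hS (by simp))).symm

theorem exists_relax_eq_trivialExtension (φ : Apx X Y) (A : Set X) (B : Set Y) (ε : ℝ≥0∞) :
    ∃ ψ : Apx A B, (relax φ (A ×ˢ B) ε).1 = trivialExtension ψ.1 := by
  refine ⟨⟨fun a b => φ.1 a b + ε, ?_⟩, ?_⟩
  · refine isApproxIsometry_of_le (δ := fun (a : A) (b : B) => φ.1 a b)
      ⟨fun b a a' => φ.2.1 b a a', fun a b b' => φ.2.2 a b b'⟩
      (fun _ _ => le_self_add) (fun a a' b => ?_) (fun a b b' => ?_)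
    · rw [← add_assoc]
      exact add_le_add ((φ.2.1 b a a').1) le_rfl
    · rw [add_right_comm]
      refine add_le_add (((φ.2.2 a b b').1).trans ?_) le_rfl
      rw [add_comm, edist_comm, Subtype.edist_eq]
  · funext x y
    rw [relax_apply]
    exact le_antisymm (le_iInf₂ fun a b => iInf₂_le (a.1, b.1) ⟨a.2, b.2⟩)
      (le_iInf₂ fun k hk => iInf₂_le
        (f := fun (a : A) (b : B) => edist x a + (φ.1 a b + ε) + edist (b : Y) y)
        ⟨k.1, hk.1⟩ ⟨k.2, hk.2⟩)

theorem StrictlyRefines.mono {φ ψ ψ' : Apx X Y} (h : StrictlyRefines φ ψ) (h' : ψ ≤ ψ') :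
    StrictlyRefines φ ψ' :=
  interior_mono (fun _ (hρ : _ ≤ ψ) => hρ.trans h') h

theorem StrictlyRefines.le {φ ψ : Apx X Y} (h : StrictlyRefines φ ψ) : φ ≤ ψ :=
  interior_subset (s := {ρ : Apx X Y | ρ ≤ ψ}) h

end Approx

/-! ### Strictly approximate isomorphisms and joint embeddings -/

section Banach

variable {X Y D : Type u} [NormedAddCommGroup X] [NormedSpace ℝ X] [NormedAddCommGroup Y]
  [NormedSpace ℝ Y] [NormedAddCommGroup D] [NormedSpace ℝ D]

/-- The distance between `X` and `Y` in a joint embedding. -/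
noncomputable def jointApx (i : X →ₗᵢ[ℝ] D) (j : Y →ₗᵢ[ℝ] D) : Apx X Y :=
  ⟨fun x y => edist (i x) (j y), isApproxIsometry_edist i.isometry j.isometry⟩

/-- The inverse of a linear isometry, on a subspace of its range. -/
noncomputable def invOn (j : Y →ₗᵢ[ℝ] D) (V : Submodule ℝ D)
    (h : V ≤ LinearMap.range j.toLinearMap) : V →ₗᵢ[ℝ] Y :=
  ⟨j.equivRange.symm.toLinearEquiv.toLinearMap ∘ₗ V.subtype.codRestrict _ fun v => h v.2,
    fun _ => j.equivRange.symm.norm_map _⟩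

theorem apply_invOn (j : Y →ₗᵢ[ℝ] D) (V : Submodule ℝ D)
    (h : V ≤ LinearMap.range j.toLinearMap) (v : V) : j (invOn j V h v) = v :=
  congrArg Subtype.val (j.equivRange.apply_symm_apply ⟨v, h v.2⟩)

variable [CompleteSpace X] [CompleteSpace Y]

/-- For a finite set `S` of pairs, let `C` be the span in `D` of the images of their entries.
Composing a restriction of `i` into `C` with a restriction of the inverse of `j` gives a member of
`Apx₂` with the same values as the joint distance on `S`. The limit over `S` is the joint distance
itself. -/
theorem jointApx_mem_apxIso (i : X →ₗᵢ[ℝ] D) (j : Y →ₗᵢ[ℝ] D) :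
    jointApx i j ∈ ApxIso finDimBanach (banachStructure X) (banachStructure Y) := by
  have key : ∀ S : Finset (X × Y), ∃ φ : Apx X Y,
      φ ∈ Apx₂ finDimBanach (banachStructure X) (banachStructure Y) ∧
      ∀ k ∈ S, φ.1 k.1 k.2 = edist (i k.1) (j k.2) := by
    intro S
    let C : Submodule ℝ D := Submodule.span ℝ ((fun k : X × Y => i k.1) '' S ∪
      (fun k : X × Y => j k.2) '' S)
    have hC : FiniteDimensional ℝ C := FiniteDimensional.span_of_finite ℝ
      ((S.finite_toSet.image _).union (S.finite_toSet.image _))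
    have hCX : ∀ k ∈ S, i k.1 ∈ C := fun k hk =>
      Submodule.subset_span (Or.inl (mem_image_of_mem (fun k : X × Y => i k.1) hk))
    have hCY : ∀ k ∈ S, j k.2 ∈ C := fun k hk =>
      Submodule.subset_span (Or.inr (mem_image_of_mem (fun k : X × Y => j k.2) hk))
    let T : (C.comap i.toLinearMap) →ₗᵢ[ℝ] C :=
      ⟨(i.toLinearMap ∘ₗ Submodule.subtype _).codRestrict C fun v => v.2,
        fun v => i.norm_map v⟩
    obtain ⟨g, hg, hgT⟩ := exists_finitePartialIso (X := X) (Y := C)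
      (S.finite_toSet.image Prod.fst) (C.comap i.toLinearMap)
      (C.closed_of_finiteDimensional.preimage i.continuous)
      (by rintro _ ⟨k, hk, rfl⟩; exact hCX k hk) T
    let j' : LinearMap.range j.toLinearMap →ₗᵢ[ℝ] Y :=
      invOn j _ le_rfl
    let V : Submodule ℝ C := (LinearMap.range j.toLinearMap).comap C.subtype
    let U : V →ₗᵢ[ℝ] Y :=
      ⟨j'.toLinearMap ∘ₗ (C.subtype ∘ₗ V.subtype).codRestrict _ fun v => v.2,
        fun v => j'.norm_map _⟩
    have hU : ∀ v : V, j (U v) = (v : C) := fun v => apply_invOn j _ le_rfl _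
    obtain ⟨f, hf, hfU⟩ := exists_finitePartialIso (X := C) (Y := Y)
      (S := Subtype.val ⁻¹' ((fun k : X × Y => j k.2) '' S))
      ((S.finite_toSet.image _).preimage Subtype.val_injective.injOn) V
      V.closed_of_finiteDimensional
      (by rintro ⟨c, hc⟩ ⟨k, hk, rfl⟩; exact ⟨k.2, rfl⟩) U
    have hci : ∀ c : C, ∀ y, edist (c : D) (j y) ≤ ofPartialMap f.toFun c y :=
      edist_le_ofPartialMap (D := D) C.subtypeₗᵢ.isometry j.isometry fun a => by
        obtain ⟨a, ha⟩ := a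
        have ha' := ha
        rw [hf] at ha'
        exact (hU ⟨a, _⟩).symm.trans (congrArg j (hfU a ha').symm)
    have hic : ∀ x, ∀ c : C, edist (i x) (c : D) ≤ ofPartialMap g.toFun x c :=
      edist_le_ofPartialMap (D := D) i.isometry C.subtypeₗᵢ.isometry fun a => by
        obtain ⟨a, ha⟩ := a
        have ha' := ha
        rw [hg] at ha'
        exact congrArg C.subtype (hgT a ha').symm
    have hle := edist_le_comp (i := i) (j := j) (c := fun c : C => (c : D)) hic hci
    refine ⟨⟨comp (ofPartialMap f.toFun) (ofPartialMap g.toFun), isApproxIsometry_of_le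
      (jointApx i j).2 hle ?_ ?_⟩, ⟨banachStructure C, banachStructure_mem, g, f, rfl⟩,
      fun k hk => le_antisymm ?_ (hle _ _)⟩
    · exact comp_le_add_left (fun x x' c => ofPartialMap_le_add_left _ x x' c) _
    · exact comp_le_add_right (fun c y y' => ofPartialMap_le_add_right _ c y y') _
    · let z : C := ⟨i k.1, hCX k hk⟩
      let w : C := ⟨j k.2, hCY k hk⟩
      have hk1 : k.1 ∈ Prod.fst '' (S : Set (X × Y)) := mem_image_of_mem _ hk
      have hk2 : w ∈ (Subtype.val ⁻¹' ((fun k : X × Y => j k.2) '' S) : Set C) :=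
        mem_image_of_mem (fun k : X × Y => j k.2) hk
      have hg0 : ofPartialMap g.toFun k.1 z ≤ 0 := by
        refine (iInf_le _ ⟨k.1, hg.symm ▸ hk1⟩).trans ?_
        have := hgT k.1 hk1
        refine (add_le_add le_rfl ((congrArg (fun c : C => edist c z) this).le)).trans ?_
        exact (congrArg₂ (· + ·) (edist_self k.1) (edist_self z)).le.trans (add_zero _).le
      have hf0 : ofPartialMap f.toFun z k.2 ≤ edist (i k.1) (j k.2) := by
        refine (iInf_le _ ⟨w, hf.symm ▸ hk2⟩).trans ?_
        have h1 : U ⟨w, ⟨k.2, rfl⟩⟩ = k.2 := j.injective (hU _)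
        have h2 := (hfU w hk2).trans h1
        refine (add_le_add le_rfl ((congrArg (fun c : Y => edist c k.2) h2).le)).trans ?_
        exact (congrArg (edist z w + ·) (edist_self k.2)).le.trans (add_zero _).le
      exact (iInf_le _ z).trans ((add_le_add hg0 hf0).trans (zero_add _).le)
  choose φ hφ hφ' using key
  refine mem_closure_of_tendsto (f := φ) (b := Filter.atTop) ?_
    (Filter.Eventually.of_forall fun S => ⟨φ S, hφ S, le_rfl⟩)
  exact Apx.tendsto_of_eq hφ'

/-- Amalgamating `X` with the middle space along `g`, then the result with `Y` along `f`, makes both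
partial isometries identifications; the triangle inequality bounds the joint distance by the
composition. -/
theorem exists_jointApx_le_of_mem_apx₂ {ψ : Apx X Y}
    (h : ψ ∈ Apx₂ finDimBanach (banachStructure X) (banachStructure Y)) :
    ∃ (D : Type u) (_ : NormedAddCommGroup D) (_ : NormedSpace ℝ D)
      (i : X →ₗᵢ[ℝ] D) (j : Y →ₗᵢ[ℝ] D), jointApx i j ≤ ψ := by
  obtain ⟨C, hC, g, f, hψ⟩ := h
  obtain ⟨Z, _, _, _, _, rfl⟩ := mem_finDimBanach_iff.1 hC
  obtain ⟨Tg, hTg⟩ := g.exists_linearIsometry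
  obtain ⟨Tf, hTf⟩ := f.exists_linearIsometry
  obtain ⟨D₁, _, _, i₁, c₁, h₁, -⟩ := exists_amalgam (Submodule.subtype _) Tg.toLinearMap le_rfl
    (fun v => by simp)
  obtain ⟨D₂, _, _, i₂, j, h₂, -⟩ := exists_amalgam (c₁.toLinearMap ∘ₗ Submodule.subtype _)
    Tf.toLinearMap le_rfl (fun v => by simp)
  refine ⟨D₂, _, _, i₂.comp i₁, j, Apx.le_iff.2 fun x y => ?_⟩
  have h₁' : ∀ v, i₁ (Submodule.subtype _ v) = c₁ (Tg v) := fun v =>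
    sub_eq_zero.1 (norm_le_zero_iff.1 ((h₁ v).trans (zero_mul _).le))
  have h₂' : ∀ v, i₂ (c₁ (Submodule.subtype _ v)) = j (Tf v) := fun v =>
    sub_eq_zero.1 (norm_le_zero_iff.1 ((h₂ v).trans (zero_mul _).le))
  refine le_of_le_of_eq ?_ (congrFun (congrFun hψ x) y).symm
  refine edist_le_comp (i := i₂.comp i₁) (j := j) (c := i₂.comp c₁) (Y := Z) ?_ ?_ x y
  · refine edist_le_ofPartialMap (D := D₂) (i₂.comp i₁).isometry (i₂.comp c₁).isometry fun a => ?_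
    obtain ⟨a, ha⟩ := a
    exact congrArg i₂ ((h₁' ⟨a, Submodule.subset_span ha⟩).trans (congrArg c₁ (hTg a ha)))
  · refine edist_le_ofPartialMap (D := D₂) (i₂.comp c₁).isometry j.isometry fun a => ?_
    obtain ⟨a, ha⟩ := a
    exact (h₂' ⟨a, Submodule.subset_span ha⟩).trans (congrArg j (hTf a ha))

/-- The joint distance lies in a closure and in the interior of the set below its relaxation, so
some coarsening of a member of `Apx₂` also lies below. -/
theorem relax_mem_stx (i : X →ₗᵢ[ℝ] D) (j : Y →ₗᵢ[ℝ] D) {S : Set (X × Y)} (hS : S.Finite)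
    {ε : ℝ≥0∞} (hε : 0 < ε) :
    relax (jointApx i j) S ε ∈ Stx finDimBanach (banachStructure X) (banachStructure Y) := by
  have h1 := jointApx_mem_apxIso i j
  have h2 : StrictlyRefines (jointApx i j) (relax (jointApx i j) S ε) :=
    strictlyRefines_relax (fun x y => edist_lt_top _ _) hS hε
  refine ⟨?_, (show Apx X Y from jointApx i j), h1, h2⟩
  obtain ⟨ρ, hρ, φ, hφ, hφρ⟩ := mem_closure_iff.1 h1 _ isOpen_interior h2
  exact subset_closure ⟨φ, hφ, hφρ.trans (StrictlyRefines.le (X := X) (Y := Y) hρ)⟩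

/-- The strict refinement given by membership is only a limit. The open set around it contains a
coarsening `ρ` of a member of `Apx₂`, which still strictly refines `ψ` and has a joint distance
below it. -/
theorem exists_relax_le_of_mem_stx {ψ : Apx X Y}
    (h : ψ ∈ Stx finDimBanach (banachStructure X) (banachStructure Y)) :
    ∃ (D : Type u) (_ : NormedAddCommGroup D) (_ : NormedSpace ℝ D)
      (i : X →ₗᵢ[ℝ] D) (j : Y →ₗᵢ[ℝ] D) (S : Set (X × Y)) (ε : ℝ≥0∞), S.Finite ∧ 0 < ε ∧ ε < ∞ ∧
        relax (jointApx i j) S ε ≤ ψ := by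
  obtain ⟨-, φ₀, hφ₀, h0⟩ := h
  obtain ⟨ρ, hρ, φ, hφ, hφρ⟩ := mem_closure_iff.1 hφ₀ _ isOpen_interior h0
  have hρ' : StrictlyRefines (X := X) (Y := Y) ρ ψ := hρ
  obtain ⟨S, hS, ε, hε, hε', h1⟩ := hρ'.exists_relax_le
  obtain ⟨D, _, _, i, j, hD⟩ := exists_jointApx_le_of_mem_apx₂ hφ
  exact ⟨D, _, _, i, j, S, ε, hS, hε, hε', (relax_mono (hD.trans hφρ) S ε).trans h1⟩

theorem exists_jointApx_le_of_mem_stx {ψ : Apx X Y}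
    (h : ψ ∈ Stx finDimBanach (banachStructure X) (banachStructure Y)) :
    ∃ (D : Type u) (_ : NormedAddCommGroup D) (_ : NormedSpace ℝ D)
      (i : X →ₗᵢ[ℝ] D) (j : Y →ₗᵢ[ℝ] D), jointApx i j ≤ ψ := by
  obtain ⟨D, _, _, i, j, S, ε, -, -, -, h⟩ := exists_relax_le_of_mem_stx h
  exact ⟨D, _, _, i, j, (le_relax _ S ε).trans h⟩

end Banach

/-! ### The intrinsic distance through joint embeddings -/

section IntrinsicDist

variable {X Y D : Type u} [NormedAddCommGroup X] [NormedSpace ℝ X] [CompleteSpace X]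
  [NormedAddCommGroup Y] [NormedSpace ℝ Y] [CompleteSpace Y] [NormedAddCommGroup D]
  [NormedSpace ℝ D] {n : ℕ}

/-- The generating tuple `x` of the finite-dimensional space `X`. -/
noncomputable def genTuple [FiniteDimensional ℝ X] (x : Fin n → X)
    (h : Submodule.span ℝ (range x) = ⊤) : GenTuple finDimBanach.{u} n :=
  ⟨banachStructure X, banachStructure_mem, x,
    (banachGenerated_eq_span (finite_range x)).trans (congrArg SetLike.coe h)⟩

theorem GenTuple.exists_eq {n : ℕ} (a : GenTuple finDimBanach.{u} n) :
    ∃ (X : Type u) (_ : NormedAddCommGroup X) (_ : NormedSpace ℝ X) (_ : CompleteSpace X)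
      (_ : FiniteDimensional ℝ X) (x : Fin n → X)
      (h : Submodule.span ℝ (range x) = ⊤), a = genTuple x h := by
  obtain ⟨A, hA, x, hx⟩ := a
  obtain ⟨X, i1, i2, i3, i4, rfl⟩ := mem_finDimBanach_iff.1 hA
  exact ⟨X, i1, i2, i3, i4, x, SetLike.coe_injective
    ((banachGenerated_eq_span (X := X) (finite_range x)).symm.trans hx), rfl⟩

variable [FiniteDimensional ℝ X] [FiniteDimensional ℝ Y] {x : Fin n → X}
  {hx : Submodule.span ℝ (range x) = ⊤} {y : Fin n → Y} {hy : Submodule.span ℝ (range y) = ⊤}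

/-- With `intrinsicDist_le`, this identifies the intrinsic distance with an infimum over joint
embeddings of the largest distance between corresponding entries. -/
theorem exists_joint_of_intrinsicDist_lt {r : ℝ≥0∞}
    (h : intrinsicDist (genTuple x hx) (genTuple y hy) < r) :
    ∃ (D : Type u) (_ : NormedAddCommGroup D) (_ : NormedSpace ℝ D)
      (i : X →ₗᵢ[ℝ] D) (j : Y →ₗᵢ[ℝ] D), ∀ k, edist (i (x k)) (j (y k)) < r := by
  rw [intrinsicDist, iInf_lt_iff] at h
  obtain ⟨ψ, h⟩ := h
  rw [iInf_lt_iff] at h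
  obtain ⟨hψ, h⟩ := h
  obtain ⟨D, _, _, i, j, hD⟩ := exists_jointApx_le_of_mem_stx (X := X) (Y := Y) hψ.1
  exact ⟨D, _, _, i, j, fun k => ((Apx.le_iff.1 hD (x k) (y k)).trans
    (le_iSup (fun k => ψ.1 (x k) (y k)) k)).trans_lt h⟩

theorem intrinsicDist_le (i : X →ₗᵢ[ℝ] D) (j : Y →ₗᵢ[ℝ] D) {r : ℝ≥0∞}
    (h : ∀ k, edist (i (x k)) (j (y k)) ≤ r) :
    intrinsicDist (genTuple x hx) (genTuple y hy) ≤ r := by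
  refine ENNReal.le_of_forall_pos_le_add fun ε hε _ => ?_
  have hε' : (0 : ℝ≥0∞) < ε := by exact_mod_cast hε
  let S : Set (X × Y) := range x ×ˢ range y
  -- Adding `ε` makes the joint distance strictly approximate; relaxing from the entries of the
  -- tuples only makes it a trivial extension.
  let ψ : Apx X Y := relax (jointApx i j) S ε
  have hψ : ψ ∈ StxTuple (genTuple x hx) (genTuple y hy) :=
    ⟨relax_mem_stx i j ((finite_range x).prod (finite_range y)) hε',
      exists_relax_eq_trivialExtension (jointApx i j) (range x) (range y) ε⟩
  refine (iInf₂_le ψ hψ).trans (iSup_le fun k => ?_)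
  exact (relax_le (jointApx i j) (S := S) ε
    (x := x k) (y := y k) ⟨mem_range_self k, mem_range_self k⟩).trans (add_le_add (h k) le_rfl)

end IntrinsicDist

/-! ### Finite-dimensional Banach spaces form a Fraïssé class -/

/-! ### Seminorms on `ℝ^ι` -/

section Seminorms

/-- A seminorm is a norm composed with a linear map, and linear maps from a finite-dimensional space
are continuous. -/
theorem Seminorm.continuous_pi {ι : Type*} [Fintype ι] (p : Seminorm ℝ (ι → ℝ)) : Continuous p := by
  obtain ⟨D, _, _, π, -, hp⟩ := exists_normed_of_seminorm p
  have := (LinearMap.continuous_of_finiteDimensional π).norm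
  simpa only [hp] using this

theorem Seminorm.abs_sub_le_of_closedBall {E : Type*} [NormedAddCommGroup E] [NormedSpace ℝ E]
    {p q : Seminorm ℝ E} {c : ℝ} (h : ∀ s ∈ Metric.closedBall (0 : E) 1, |p s - q s| ≤ c) (s : E) :
    |p s - q s| ≤ c * ‖s‖ := by
  rcases eq_or_ne s 0 with rfl | hs
  · simp
  · have hs' : 0 < ‖s‖ := norm_pos_iff.2 hs
    have h3 := h (‖s‖⁻¹ • s) (by simp [norm_smul, hs'.ne'])
    simp only [map_smul_eq_mul, norm_inv, norm_norm, ← mul_sub, abs_mul, abs_inv, abs_norm] at h3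
    rwa [inv_mul_le_iff₀ hs', mul_comm] at h3

/-- Any family of seminorms on `ℝ^ι` has a countable dense subfamily. -/
theorem exists_countable_dense_seminorm {ι : Type*} [Fintype ι] {α : Type*}
    (Φ : α → Seminorm ℝ (ι → ℝ)) : ∃ S : Set α, S.Countable ∧ ∀ (a : α) (ε : ℝ), 0 < ε →
      ∃ b ∈ S, ∀ s, |Φ a s - Φ b s| ≤ ε * ‖s‖ := by
  let K : Set (ι → ℝ) := Metric.closedBall 0 1
  have : CompactSpace K := isCompact_iff_compactSpace.1 (isCompact_closedBall _ _)
  let F : α → C(K, ℝ) := fun a =>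
    ⟨fun s => Φ a s, (Seminorm.continuous_pi _).comp continuous_subtype_val⟩
  -- Second countability of `C(K, ℝ)` passes to the index set with the induced topology, so the
  -- dense subfamily can be found inside an arbitrary family.
  let _ : PseudoMetricSpace α := PseudoMetricSpace.induced F inferInstance
  have : SecondCountableTopology α := TopologicalSpace.secondCountableTopology_induced α _ F
  obtain ⟨S, hS, hd⟩ := TopologicalSpace.exists_countable_dense α
  refine ⟨S, hS, fun a ε hε => ?_⟩
  obtain ⟨b, hb, hab⟩ := hd.exists_dist_lt a hε
  refine ⟨b, hb, fun s => ?_⟩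
  have h1 : dist (F a) (F b) < ε := hab
  have h2 : ∀ t : K, |Φ a t - Φ b t| ≤ ε := fun t =>
    (ContinuousMap.dist_apply_le_dist (f := F a) (g := F b) t).trans h1.le
  exact Seminorm.abs_sub_le_of_closedBall (fun t ht => h2 ⟨t, ht⟩) s

theorem sum_norm_le_card_mul_norm {ι : Type*} [Fintype ι] (s : ι → ℝ) :
    ∑ k, ‖s k‖ ≤ Fintype.card ι * ‖s‖ := by
  simpa using Finset.sum_le_card_nsmul Finset.univ (fun k => ‖s k‖) ‖s‖ fun k _ =>
    norm_le_pi_norm s k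

/-- Linear combinations of two families which are close in a joint embedding have close norms. -/
theorem abs_norm_sum_sub_norm_sum_le {ι X Y D : Type*} [Fintype ι] [NormedAddCommGroup X]
    [NormedSpace ℝ X] [NormedAddCommGroup Y] [NormedSpace ℝ Y] [NormedAddCommGroup D]
    [NormedSpace ℝ D] (i : X →ₗᵢ[ℝ] D) (j : Y →ₗᵢ[ℝ] D) {x : ι → X} {y : ι → Y} {r : ℝ}
    (hr : 0 ≤ r) (h : ∀ k, ‖i (x k) - j (y k)‖ ≤ r) (s : ι → ℝ) :
    |‖∑ k, s k • x k‖ - ‖∑ k, s k • y k‖| ≤ r * (Fintype.card ι * ‖s‖) := by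
  rw [← i.norm_map, ← j.norm_map]
  refine (abs_norm_sub_norm_le _ _).trans ?_
  rw [map_sum, map_sum, ← Finset.sum_sub_distrib]
  calc ‖∑ k, (i (s k • x k) - j (s k • y k))‖ ≤ ∑ k, r * ‖s k‖ := norm_sum_le_of_le _ fun k _ => by
        rw [map_smul, map_smul, ← smul_sub, norm_smul, mul_comm]
        exact mul_le_mul_of_nonneg_right (h k) (norm_nonneg _)
    _ ≤ _ := by
        rw [← Finset.mul_sum]
        exact mul_le_mul_of_nonneg_left (sum_norm_le_card_mul_norm s) hr

end Seminorms

/-! ### Generating tuples as seminorms on `ℝⁿ` -/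

section GenTuple

variable {X Y : Type u} [NormedAddCommGroup X] [NormedSpace ℝ X] [CompleteSpace X]
  [NormedAddCommGroup Y] [NormedSpace ℝ Y] [CompleteSpace Y] {n : ℕ}
  [FiniteDimensional ℝ X] [FiniteDimensional ℝ Y] {x : Fin n → X}
  {hx : Submodule.span ℝ (range x) = ⊤} {y : Fin n → Y} {hy : Submodule.span ℝ (range y) = ⊤}

/-- `p` is the seminorm that a generating tuple induces on `ℝⁿ`. -/
def IsSeminormOf (a : GenTuple finDimBanach.{u} n) (p : Seminorm ℝ (Fin n → ℝ)) : Prop :=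
  ∃ (X : Type u) (_ : NormedAddCommGroup X) (_ : NormedSpace ℝ X) (_ : CompleteSpace X)
      (_ : FiniteDimensional ℝ X) (x : Fin n → X)
      (h : Submodule.span ℝ (range x) = ⊤), a = genTuple x h ∧
      ∀ s, p s = ‖Fintype.linearCombination ℝ x s‖

theorem exists_isSeminormOf (a : GenTuple finDimBanach.{u} n) : ∃ p, IsSeminormOf a p := by
  obtain ⟨X, i1, i2, i3, i4, x, hx, rfl⟩ := a.exists_eq
  exact ⟨(normSeminorm ℝ X).comp (Fintype.linearCombination ℝ x), X, i1, i2, i3, i4, x, hx, rfl,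
    fun s => rfl⟩

theorem exists_genTuple_isSeminormOf (p : Seminorm ℝ (Fin n → ℝ)) :
    ∃ a : GenTuple finDimBanach.{u} n, IsSeminormOf a p := by
  -- `ULift` places `ℝⁿ` in the universe of the class.
  obtain ⟨D, i1, i2, π, hπ, hp⟩ := exists_normed_of_seminorm
    (p.comp (ULift.moduleEquiv : ULift.{u} (Fin n → ℝ) ≃ₗ[ℝ] _).toLinearMap)
  have : FiniteDimensional ℝ D := Module.Finite.of_surjective π hπ
  have : CompleteSpace D := FiniteDimensional.complete ℝ D
  let π' : (Fin n → ℝ) →ₗ[ℝ] D := π ∘ₗ ULift.moduleEquiv.symm.toLinearMap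
  have h1 : Fintype.linearCombination ℝ (fun k => π' (Pi.single k 1)) = π' := by
    refine LinearMap.pi_ext' fun k => LinearMap.ext_ring ?_
    simp
  refine ⟨genTuple (fun k => π' (Pi.single k 1)) ?_, D, i1, i2, _, _, _, _, rfl, fun s => ?_⟩
  · rw [← Fintype.range_linearCombination ℝ, h1, LinearMap.range_eq_top]
    exact hπ.comp ULift.moduleEquiv.symm.surjective
  · rw [h1]
    exact (hp (ULift.up s)).symm

/-- The two spaces are amalgamated over `ℝⁿ` with the sup norm; the unit vectors, of norm at most
`1`, give corresponding entries at distance at most `ε`. -/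
theorem intrinsicDist_le_of_seminorm {a b : GenTuple finDimBanach.{u} n}
    {p q : Seminorm ℝ (Fin n → ℝ)} (ha : IsSeminormOf a p) (hb : IsSeminormOf b q) {ε : ℝ}
    (hε : 0 ≤ ε) (h : ∀ s, |p s - q s| ≤ ε * ‖s‖) : intrinsicDist a b ≤ ENNReal.ofReal ε := by
  obtain ⟨X, i1, i2, i3, i4, x, hx, rfl, hp⟩ := ha
  obtain ⟨Y, j1, j2, j3, j4, y, hy, rfl, hq⟩ := hb
  obtain ⟨D, _, _, i, j, hD, -⟩ := exists_amalgam (Fintype.linearCombination ℝ x)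
    (Fintype.linearCombination ℝ y) hε (by simpa only [hp, hq] using h)
  refine intrinsicDist_le i j fun k => ?_
  have := hD (Pi.single k 1)
  rw [Fintype.linearCombination_apply_single, Fintype.linearCombination_apply_single, one_smul,
    one_smul, ← dist_eq_norm] at this
  rw [edist_dist]
  exact ENNReal.ofReal_le_ofReal (this.trans (by simp [Pi.norm_single]))

theorem seminorm_sub_le_of_intrinsicDist_lt {a b : GenTuple finDimBanach.{u} n}
    {p q : Seminorm ℝ (Fin n → ℝ)} (ha : IsSeminormOf a p) (hb : IsSeminormOf b q) {ε : ℝ}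
    (h : intrinsicDist a b < ENNReal.ofReal ε) (s : Fin n → ℝ) :
    |p s - q s| ≤ ε * (n * ‖s‖) := by
  obtain ⟨X, i1, i2, i3, i4, x, hx, rfl, hp⟩ := ha
  obtain ⟨Y, j1, j2, j3, j4, y, hy, rfl, hq⟩ := hb
  have hε : 0 < ε := ENNReal.ofReal_pos.1 (pos_of_gt h)
  obtain ⟨D, _, _, i, j, hD⟩ := exists_joint_of_intrinsicDist_lt h
  rw [hp, hq, Fintype.linearCombination_apply, Fintype.linearCombination_apply]
  simpa using abs_norm_sum_sub_norm_sum_le i j hε.le (fun k => by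
    rw [← dist_eq_norm]; exact (edist_lt_ofReal.1 (hD k)).le) s

end GenTuple

theorem hasPP_finDimBanach : HasPP finDimBanach.{u} := by
  intro n
  choose N hN using exists_isSeminormOf (n := n)
  constructor
  · obtain ⟨S, hS, h⟩ := exists_countable_dense_seminorm N
    refine ⟨S, hS, fun a ε hε => ?_⟩
    obtain ⟨r, -, hr0, hr⟩ := ENNReal.lt_iff_exists_real_btwn.1 hε
    obtain ⟨b, hb, hab⟩ := h a r (ENNReal.ofReal_pos.1 hr0)
    exact ⟨b, hb, (intrinsicDist_le_of_seminorm (hN a) (hN b) (ENNReal.ofReal_pos.1 hr0).le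
      hab).trans_lt hr⟩
  · intro a ha
    have hcau : ∀ ε : ℝ, 0 < ε → ∃ M, ∀ i ≥ M, ∀ j ≥ M, ∀ s, |N (a i) s - N (a j) s| ≤ ε * ‖s‖ := by
      intro ε hε
      -- Passing from tuples to seminorms costs a factor `n`; `n + 1` absorbs it without a case `n =
      -- 0`.
      obtain ⟨M, hM⟩ := ha (ENNReal.ofReal (ε / (n + 1))) (by simp; positivity)
      refine ⟨M, fun i hi j hj s => ?_⟩
      refine (seminorm_sub_le_of_intrinsicDist_lt (hN _) (hN _) (hM i hi j hj) s).trans ?_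
      rw [← mul_assoc]
      refine mul_le_mul_of_nonneg_right ?_ (norm_nonneg s)
      rw [div_mul_eq_mul_div, div_le_iff₀ (by positivity)]
      nlinarith
    have hlim : ∀ s, ∃ l, Filter.Tendsto (fun i => N (a i) s) Filter.atTop (𝓝 l) := by
      intro s
      refine cauchySeq_tendsto_of_complete (Metric.cauchySeq_iff.2 fun ε hε => ?_)
      obtain ⟨M, hM⟩ := hcau (ε / (‖s‖ + 1)) (by positivity)
      refine ⟨M, fun i hi j hj => (hM i hi j hj s).trans_lt ?_⟩
      rw [div_mul_eq_mul_div, div_lt_iff₀ (by positivity)]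
      nlinarith [norm_nonneg s]
    choose l hl using hlim
    let p : Seminorm ℝ (Fin n → ℝ) := Seminorm.ofSMulLE l
      (tendsto_nhds_unique (hl 0) (by simp))
      (fun s t => le_of_tendsto_of_tendsto' (hl _) ((hl s).add (hl t)) fun i =>
        map_add_le_add _ _ _)
      (fun r s => le_of_tendsto_of_tendsto' (hl _) ((hl s).const_mul _) fun i =>
        (map_smul_eq_mul _ _ _).le)
    obtain ⟨b, hb⟩ := exists_genTuple_isSeminormOf.{u} p
    refine ⟨b, fun ε hε => ?_⟩
    obtain ⟨r, -, hr0, hr⟩ := ENNReal.lt_iff_exists_real_btwn.1 hε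
    obtain ⟨M, hM⟩ := hcau r (ENNReal.ofReal_pos.1 hr0)
    refine ⟨M, fun i hi => (intrinsicDist_le_of_seminorm (hN (a i)) hb
      (ENNReal.ofReal_pos.1 hr0).le fun s => ?_).trans_lt hr⟩
    exact le_of_tendsto ((tendsto_const_nhds.sub (hl s)).abs)
      (Filter.eventually_atTop.2 ⟨M, fun j hj => hM i hi j hj s⟩)

theorem exists_lipschitz_banachFunMap {n : ℕ} (f : BanachFunctions n) : ∃ C : ℝ, 1 ≤ C ∧
    ∀ {X Y D : Type u} [NormedAddCommGroup X] [NormedSpace ℝ X] [NormedAddCommGroup Y]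
      [NormedSpace ℝ Y] [NormedAddCommGroup D] [NormedSpace ℝ D] (i : X →ₗᵢ[ℝ] D)
      (j : Y →ₗᵢ[ℝ] D) (x : Fin n → X) (y : Fin n → Y) (δ : ℝ), 0 ≤ δ →
      (∀ k, ‖i (x k) - j (y k)‖ ≤ δ) →
        ‖i (banachFunMap X f x) - j (banachFunMap Y f y)‖ ≤ C * δ := by
  cases f with
  | zero =>
    refine ⟨1, le_rfl, fun {X Y D} _ _ _ _ _ _ i j x y δ hδ h => ?_⟩
    simpa [banachFunMap] using hδ
  | add =>
    refine ⟨2, one_le_two, fun {X Y D} _ _ _ _ _ _ i j x y δ hδ h => ?_⟩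
    simp only [banachFunMap, map_add]
    rw [add_sub_add_comm, two_mul]
    exact norm_add_le_of_le (h 0) (h 1)
  | smul r =>
    refine ⟨1 + ‖r‖, by simp, fun {X Y D} _ _ _ _ _ _ i j x y δ hδ h => ?_⟩
    simp only [banachFunMap, map_smul]
    rw [← smul_sub, norm_smul]
    exact mul_le_mul (by simp) (h 0) (norm_nonneg _) (by positivity)

theorem intrinsicDist_appendFun_le {X Y D : Type u} [NormedAddCommGroup X] [NormedSpace ℝ X]
    [CompleteSpace X] [FiniteDimensional ℝ X] [NormedAddCommGroup Y] [NormedSpace ℝ Y]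
    [CompleteSpace Y] [FiniteDimensional ℝ Y] [NormedAddCommGroup D] [NormedSpace ℝ D] {n m : ℕ}
    {x : Fin (n + m) → X} {hx : Submodule.span ℝ (range x) = ⊤} {y : Fin (n + m) → Y}
    {hy : Submodule.span ℝ (range y) = ⊤} (f : BanachFunctions n) (i : X →ₗᵢ[ℝ] D)
    (j : Y →ₗᵢ[ℝ] D) {r : ℝ≥0∞} (h : ∀ k, edist (i (x k)) (j (y k)) ≤ r)
    (hf : edist (i (banachFunMap X f fun k => x (Fin.castAdd m k)))
      (j (banachFunMap Y f fun k => y (Fin.castAdd m k))) ≤ r) :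
    intrinsicDist ((genTuple x hx).appendFun (L := banachLanguage) f)
      ((genTuple y hy).appendFun (L := banachLanguage) f) ≤ r := by
  have hspan : ∀ {Z : Type u} [NormedAddCommGroup Z] [NormedSpace ℝ Z] (z : Fin (n + m) → Z)
      (w : Z), Submodule.span ℝ (range z) = ⊤ →
      Submodule.span ℝ (range (Fin.snoc (α := fun _ => Z) z w)) = ⊤ := fun z w hz =>
    top_unique (hz.symm.le.trans (Submodule.span_mono (by
      rintro _ ⟨k, rfl⟩
      exact ⟨k.castSucc, by simp⟩)))
  refine intrinsicDist_le (x := Fin.snoc (α := fun _ => X) x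
    (banachFunMap X f fun k => x (Fin.castAdd m k)))
    (y := Fin.snoc (α := fun _ => Y) y (banachFunMap Y f fun k => y (Fin.castAdd m k)))
    (hx := hspan x _ hx) (hy := hspan y _ hy) i j fun k => ?_
  refine Fin.lastCases ?_ (fun k => ?_) k
  · simpa using hf
  · simpa using h k

theorem isFraisseClass_finDimBanach : IsFraisseClass finDimBanach.{u} where
  fg A hA := by
    obtain ⟨X, _, _, _, _, rfl⟩ := mem_finDimBanach_iff.1 hA
    exact isFG_banachStructure_iff.2 ‹_›
  hp A hA := by
    obtain ⟨X, _, _, _, _, rfl⟩ := mem_finDimBanach_iff.1 hA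
    exact isKStructure_banachStructure X
  jep A hA B hB := by
    obtain ⟨X, _, _, _, _, rfl⟩ := mem_finDimBanach_iff.1 hA
    obtain ⟨Y, _, _, _, _, rfl⟩ := mem_finDimBanach_iff.1 hB
    -- Zero maps identify nothing: the amalgam is the `ℓ¹`-sum.
    obtain ⟨D, _, _, i, j, -, hD⟩ := exists_amalgam (0 : ℝ →ₗ[ℝ] X) (0 : ℝ →ₗ[ℝ] Y) le_rfl
      (fun v => by simp)
    have := finiteDimensional_of_forall_exists_add i j hD
    have : CompleteSpace D := FiniteDimensional.complete ℝ D
    exact ⟨banachStructure D, banachStructure_mem, ⟨embeddingOfLinearIsometry i⟩,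
      ⟨embeddingOfLinearIsometry j⟩⟩
  nap A hA B hB f ε hε := by
    obtain ⟨X, _, _, _, _, rfl⟩ := mem_finDimBanach_iff.1 hA
    obtain ⟨Y, _, _, _, _, rfl⟩ := mem_finDimBanach_iff.1 hB
    obtain ⟨T, hT⟩ := f.exists_linearIsometry
    -- Error `0`: the amalgamation over the span of the domain is exact, not just near.
    obtain ⟨D, _, _, i, j, hij, hD⟩ := exists_amalgam (Submodule.subtype _) T.toLinearMap le_rfl
      (fun v => by simp)
    have := finiteDimensional_of_forall_exists_add i j hD
    have : CompleteSpace D := FiniteDimensional.complete ℝ D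
    refine ⟨banachStructure D, banachStructure_mem, embeddingOfLinearIsometry i,
      embeddingOfLinearIsometry j, fun ⟨a, ha⟩ => ?_⟩
    have h1 := hij ⟨a, Submodule.subset_span ha⟩
    rw [← dist_eq_norm, zero_mul] at h1
    refine le_trans (le_of_eq ?_) (h1.trans hε.le)
    exact congrArg (fun y => dist (i a) (j y)) (hT a ha).symm
  pp := hasPP_finDimBanach
  cp := by
    refine ⟨fun a ε hε => ?_, fun n R a ε hε => ?_, fun n m f a ε hε => ?_⟩
    · obtain ⟨X, _, _, _, _, x, hx, rfl⟩ := a.exists_eq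
      refine ⟨ENNReal.ofReal (ε / 2), by simpa using hε, fun b hb => ?_⟩
      obtain ⟨Y, _, _, _, _, y, hy, rfl⟩ := b.exists_eq
      obtain ⟨D, _, _, i, j, hD⟩ := exists_joint_of_intrinsicDist_lt hb
      change |dist (x 0) (x 1) - dist (y 0) (y 1)| < ε
      rw [← i.dist_map, ← j.dist_map]
      have h0 := edist_lt_ofReal.1 (hD 0)
      have h1 := edist_lt_ofReal.1 (hD 1)
      have := dist_dist_dist_le (i (x 0)) (i (x 1)) (j (y 0)) (j (y 1))
      rw [Real.dist_eq] at this
      linarith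
    · obtain ⟨X, _, _, _, _, x, hx, rfl⟩ := a.exists_eq
      refine ⟨ENNReal.ofReal ε, by simpa using hε, fun b hb => ?_⟩
      obtain ⟨Y, _, _, _, _, y, hy, rfl⟩ := b.exists_eq
      obtain ⟨D, _, _, i, j, hD⟩ := exists_joint_of_intrinsicDist_lt hb
      cases R
      change |‖x 0‖ - ‖y 0‖| < ε
      rw [← i.norm_map, ← j.norm_map]
      have h0 := edist_lt_ofReal.1 (hD 0)
      rw [dist_eq_norm] at h0
      exact (abs_norm_sub_norm_le _ _).trans_lt h0
    · obtain ⟨X, _, _, _, _, x, hx, rfl⟩ := a.exists_eq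
      obtain ⟨r, -, hr0, hr⟩ := ENNReal.lt_iff_exists_real_btwn.1 hε
      obtain ⟨C, hC, hCf⟩ := exists_lipschitz_banachFunMap.{u} f
      have hr0 := ENNReal.ofReal_pos.1 hr0
      refine ⟨ENNReal.ofReal (r / C), by simp; positivity, fun b hb => ?_⟩
      obtain ⟨Y, _, _, _, _, y, hy, rfl⟩ := b.exists_eq
      obtain ⟨D, _, _, i, j, hD⟩ := exists_joint_of_intrinsicDist_lt hb
      have hD' : ∀ k, ‖i (x k) - j (y k)‖ ≤ r / C := fun k => by
        rw [← dist_eq_norm]; exact (edist_lt_ofReal.1 (hD k)).le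
      refine lt_of_le_of_lt ?_ hr
      refine intrinsicDist_appendFun_le f i j (fun k => (hD k).le.trans
        (ENNReal.ofReal_le_ofReal (div_le_self hr0.le hC))) ?_
      rw [edist_dist, dist_eq_norm]
      refine ENNReal.ofReal_le_ofReal ((hCf i j _ _ (r / C) (by positivity)
        (fun k => hD' (Fin.castAdd m k))).trans (le_of_eq (by field_simp)))

/-! ### Gurarij spaces -/

/-- A Banach space is a Gurarij space as soon as extensions exist approximately, on bases. -/
theorem isGurarij_of_approx {G : Type u} [NormedAddCommGroup G] [NormedSpace ℝ G] [CompleteSpace G]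
    [TopologicalSpace.SeparableSpace G]
    (h : ∀ (n m : ℕ) (F : Type u) [NormedAddCommGroup F] [NormedSpace ℝ F] [FiniteDimensional ℝ F]
      (b : Fin n ⊕ Fin m → F) (g : Fin n → G),
      (∀ s : Fin n → ℝ, ‖∑ k, s k • g k‖ = ‖∑ k, s k • b (Sum.inl k)‖) → ∀ η : ℝ, 0 < η →
      ∃ g' : Fin n ⊕ Fin m → G, (∀ k, ‖g' (Sum.inl k) - g k‖ ≤ η) ∧
        ∀ s : Fin n ⊕ Fin m → ℝ, |‖∑ k, s k • g' k‖ - ‖∑ k, s k • b k‖| ≤ η * ‖s‖) :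
    IsGurarij G := by
  refine ⟨inferInstance, inferInstance, fun ε hε F _ _ _ E ψ => ?_⟩
  -- A complement provides a basis of `F` whose `inl` part is a basis of `E`.
  obtain ⟨E', hE'⟩ := E.exists_isCompl
  let bE := Module.finBasis ℝ E
  let b : Module.Basis _ ℝ F :=
    (bE.prod (Module.finBasis ℝ E')).map (Submodule.prodEquivOfIsCompl E E' hE')
  have hb : ∀ k, b (Sum.inl k) = bE k := fun k => by simp [b]
  let N : ℝ := Fintype.card (Fin (Module.finrank ℝ E) ⊕ Fin (Module.finrank ℝ E'))
  have hN : 0 ≤ N := Nat.cast_nonneg _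
  let C := ‖LinearMap.toContinuousLinearMap b.equivFun.toLinearMap‖
  have hC : ∀ x, ‖b.equivFun x‖ ≤ C * ‖x‖ := fun x =>
    (LinearMap.toContinuousLinearMap b.equivFun.toLinearMap).le_opNorm x
  have hC0 : 0 ≤ C := norm_nonneg _
  -- The cap at `1 / 2` lets the lower bound force injectivity.
  let ε' := min ε (1 / 2)
  have hε' : 0 < ε' := by positivity
  let η := ε' / (2 * (N + 1) * (C + 1))
  have hη : 0 < η := by positivity
  obtain ⟨g', hg', hs⟩ := h _ _ F b (fun k => ψ (bE k)) (fun s => by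
    simp only [hb]
    have e1 : ∑ k, s k • ψ (bE k) = ψ (∑ k, s k • bE k) := by simp
    have e2 : ∑ k, s k • (bE k : F) = (∑ k, s k • bE k : E) := by simp
    rw [e1, e2, ψ.norm_map, Submodule.coe_norm]) η hη
  -- On the basis of `E` the approximate values are replaced by the exact ones. With at most `N`
  -- changes of size `η` and coordinates bounded by `C‖x‖`, the total distortion stays below `ε' / 2
  -- * ‖x‖`, which leaves room for strict inequalities.
  let v : _ → G := Sum.elim (fun k => ψ (bE k)) (fun k => g' (Sum.inr k))
  let φ : F →ₗ[ℝ] G := b.constr ℝ v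
  have hφ : ∀ x, |‖φ x‖ - ‖x‖| ≤ ε' / 2 * ‖x‖ := by
    intro x
    have h1 : φ x = ∑ k, b.equivFun x k • v k := b.constr_apply_fintype _ _ _
    have h2 := hs (b.equivFun x)
    rw [b.sum_equivFun] at h2
    have h3 := abs_norm_sum_sub_norm_sum_le (LinearIsometry.id (R := ℝ) (E := G))
      (LinearIsometry.id (R := ℝ)) (x := v) (y := g') hη.le (by
        rintro (k | k)
        · simpa [v, norm_sub_rev] using hg' k
        · simpa [v] using hη.le) (b.equivFun x)
    rw [← h1] at h3
    have h4 := (abs_sub_le _ _ _).trans (add_le_add h3 h2)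
    refine h4.trans ?_
    calc η * (N * ‖b.equivFun x‖) + η * ‖b.equivFun x‖ = η * (N + 1) * ‖b.equivFun x‖ := by ring
      _ ≤ η * (N + 1) * (C * ‖x‖) := mul_le_mul_of_nonneg_left (hC x) (by positivity)
      _ ≤ η * (N + 1) * ((C + 1) * ‖x‖) := by gcongr; linarith
      _ = _ := by simp only [η]; field_simp
  have hφ' : ∀ x : F, x ≠ 0 → (1 - ε') * ‖x‖ < ‖φ x‖ ∧ ‖φ x‖ < (1 + ε') * ‖x‖ := by
    intro x hx
    have hx' := norm_pos_iff.2 hx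
    have := abs_le.1 (hφ x)
    have := mul_pos hε' hx'
    constructor <;> linarith
  have h1 : ε' ≤ ε := min_le_left _ _
  have h2 : ε' ≤ 1 / 2 := min_le_right _ _
  refine ⟨φ, (injective_iff_map_eq_zero φ).2 fun x hx => ?_, fun x => ?_, fun x hx => ?_⟩
  · by_contra hx0
    have := (hφ' x hx0).1
    rw [hx, norm_zero] at this
    nlinarith [norm_nonneg x]
  · have : φ ∘ₗ E.subtype = ψ.toLinearMap := bE.ext fun k => by
      simp only [LinearMap.comp_apply, Submodule.subtype_apply, ← hb, φ, b.constr_basis]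
      rfl
    exact LinearMap.congr_fun this x
  · have h3 := hφ' x hx
    have := mul_le_mul_of_nonneg_right h1 (norm_nonneg x)
    exact ⟨by linarith [h3.1], by linarith [h3.2]⟩

/-! ### Approximate retractions onto a Gurarij space -/

section Extension

variable {G : Type u} [NormedAddCommGroup G] [NormedSpace ℝ G]

/-- An extension of a Gurarij space almost retracts on it, over finite-dimensional subspaces. -/
theorem IsGurarij.exists_retract (hG : IsGurarij G) {D : Type u} [NormedAddCommGroup D]
    [NormedSpace ℝ D] (j : G →ₗᵢ[ℝ] D) (F : Submodule ℝ D) [FiniteDimensional ℝ F]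
    (L : Submodule ℝ G) [FiniteDimensional ℝ L] {δ : ℝ} (hδ : 0 < δ) :
    ∃ φ : D →ₗ[ℝ] G, (∀ y ∈ L, φ (j y) = y) ∧ ∀ d ∈ F, |‖φ d‖ - ‖d‖| ≤ δ * ‖d‖ := by
  -- The Gurarij property is applied to `F + j(L)`, extending the inverse of `j` on `j(L)`; the
  -- result is then extended arbitrarily to a linear map on `D`.
  let F' : Submodule ℝ D := F ⊔ L.map j.toLinearMap
  let V : Submodule ℝ D := L.map j.toLinearMap
  let E : Submodule ℝ F' := V.comap F'.subtype
  have hV : V ≤ LinearMap.range j.toLinearMap := LinearMap.map_le_range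
  let ψ : E →ₗᵢ[ℝ] G :=
    ⟨(invOn j V hV).toLinearMap ∘ₗ (F'.subtype ∘ₗ E.subtype).codRestrict V fun x => x.2,
      fun x => (invOn j V hV).norm_map _⟩
  have hψ : ∀ x : E, j (ψ x) = (x : F') := fun x => apply_invOn j V hV _
  obtain ⟨φ₀, -, h1, h2⟩ := hG.2.2 δ hδ F' E ψ
  obtain ⟨φ, hφ⟩ := φ₀.exists_extend
  have hφ' : ∀ d : F', φ d = φ₀ d := fun d => LinearMap.congr_fun hφ d
  refine ⟨φ, fun y hy => ?_, fun d hd => ?_⟩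
  · have hyV : j y ∈ V := ⟨y, hy, rfl⟩
    rw [hφ' ⟨j y, Submodule.mem_sup_right hyV⟩, h1 ⟨⟨j y, Submodule.mem_sup_right hyV⟩, hyV⟩]
    exact j.injective (hψ _)
  · rw [hφ' ⟨d, Submodule.mem_sup_left hd⟩]
    rcases eq_or_ne d 0 with rfl | hd0
    · have : φ₀ ⟨0, Submodule.mem_sup_left hd⟩ = 0 := φ₀.map_zero
      simp [this]
    · have := h2 ⟨d, Submodule.mem_sup_left hd⟩ (fun h => hd0 (congrArg Subtype.val h))
      have hn : ‖(⟨d, Submodule.mem_sup_left hd⟩ : F')‖ = ‖d‖ := rfl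
      rw [hn] at this
      rw [abs_le]
      constructor <;> linarith [this.1, this.2]

/-- Two finite-dimensional families with almost the same norms are exchanged, approximately, by an
almost isometric map into a Gurarij space. -/
theorem IsGurarij.exists_almost_isometry (hG : IsGurarij G) {A : Type u} [NormedAddCommGroup A]
    [NormedSpace ℝ A] {V : Type*} [SeminormedAddCommGroup V] [NormedSpace ℝ V]
    [FiniteDimensional ℝ V] (T : V →ₗ[ℝ] A) (S : V →ₗ[ℝ] G) {ε : ℝ} (hε : 0 ≤ ε)
    (h : ∀ v, |‖T v‖ - ‖S v‖| ≤ ε * ‖v‖) (W : Submodule ℝ A) [FiniteDimensional ℝ W] {δ : ℝ}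
    (hδ : 0 < δ) (hδ' : δ ≤ 1) :
    ∃ g : A →ₗ[ℝ] G, (∀ x ∈ W, |‖g x‖ - ‖x‖| ≤ δ * ‖x‖) ∧
      ∀ v, ‖g (T v) - S v‖ ≤ 2 * ε * ‖v‖ := by
  obtain ⟨D, _, _, i, j, hij, -⟩ := exists_amalgam T S hε h
  obtain ⟨φ, h1, h2⟩ := hG.exists_retract j (W.map i.toLinearMap ⊔
    LinearMap.range (i.toLinearMap ∘ₗ T) ⊔ LinearMap.range (j.toLinearMap ∘ₗ S))
    (LinearMap.range S) hδ
  refine ⟨φ ∘ₗ i.toLinearMap, fun x hx => ?_, fun v => ?_⟩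
  · have := h2 (i x) (Submodule.mem_sup_left (Submodule.mem_sup_left ⟨x, hx, rfl⟩))
    rwa [i.norm_map] at this
  -- Since `φ` fixes the range of `S`, it sends this vector, of norm at most `ε‖v‖`, to `g (T v) - S
  -- v`. The factor `2` bounds `1 + δ`.
  · have h3 := h2 (i (T v) - j (S v)) (Submodule.sub_mem _
      (Submodule.mem_sup_left (Submodule.mem_sup_right ⟨v, rfl⟩))
      (Submodule.mem_sup_right ⟨v, rfl⟩))
    rw [map_sub, h1 _ ⟨v, rfl⟩] at h3
    have h4 := (abs_le.1 h3).2
    have h5 := hij v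
    change ‖φ (i (T v)) - S v‖ ≤ _
    nlinarith [norm_nonneg (i (T v) - j (S v))]

end Extension

theorem exists_seq_of_forall_step {α : Type*} (P : ℕ → α → Prop) (R : ℕ → α → α → Prop)
    (h0 : ∃ a, P 0 a) (hs : ∀ n a, P n a → ∃ b, P (n + 1) b ∧ R n a b) :
    ∃ s : ℕ → α, ∀ n, P n (s n) ∧ R n (s n) (s (n + 1)) := by
  obtain ⟨a, ha⟩ := h0
  choose! next h1 h2 using hs
  let s : ℕ → α := fun n => Nat.rec a next n
  have hs : ∀ n, P n (s n) := fun n => by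
    induction n with
    | zero => exact ha
    | succ n ih => exact h1 n _ ih
  exact ⟨s, fun n => ⟨hs n, h2 n _ (hs n)⟩⟩

/-- The limit of a sequence of almost isometric maps, on an increasing sequence of subspaces. -/
theorem exists_linearIsometry_of_approx {A B : Type*} [NormedAddCommGroup A] [NormedSpace ℝ A]
    [NormedAddCommGroup B] [NormedSpace ℝ B] [CompleteSpace B] (X : ℕ → Submodule ℝ A)
    (hX : Monotone X) (hd : Dense (⋃ n, (X n : Set A))) (f : ℕ → A →ₗ[ℝ] B) {C : ℝ}
    (h1 : ∀ n, ∀ x ∈ X n, |‖f n x‖ - ‖x‖| ≤ (1 / 2) ^ n * ‖x‖)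
    (h2 : ∀ n, ∀ x ∈ X n, ‖f (n + 1) x - f n x‖ ≤ C * (1 / 2) ^ n * ‖x‖) :
    ∃ F : A →ₗᵢ[ℝ] B, ∀ n, ∀ x ∈ X n, ‖F x - f n x‖ ≤ 2 * C * (1 / 2) ^ n * ‖x‖ := by
  let U : Submodule ℝ A := ⨆ n, X n
  have hU : ∀ x : U, ∃ n, (x : A) ∈ X n := fun x =>
    (Submodule.mem_iSup_of_directed X hX.directed_le).1 x.2
  have hstep : ∀ n, ∀ x ∈ X n, ∀ k, dist (f (k + n) x) (f (k + 1 + n) x) ≤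
      C * (1 / 2) ^ n * ‖x‖ * (1 / 2) ^ k := fun n x hx k => by
    rw [dist_comm, dist_eq_norm, add_right_comm]
    refine (h2 (k + n) x (hX (by omega) hx)).trans (le_of_eq ?_)
    rw [pow_add]; ring
  have hlim : ∀ x : U, ∃ l, Filter.Tendsto (fun n => f n x) Filter.atTop (𝓝 l) := by
    intro x
    obtain ⟨n, hn⟩ := hU x
    obtain ⟨l, hl⟩ := cauchySeq_tendsto_of_complete
      (cauchySeq_of_le_geometric (1 / 2) _ (by norm_num) (hstep n x hn))
    exact ⟨l, (Filter.tendsto_add_atTop_iff_nat n).1 hl⟩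
  choose l hl using hlim
  let g : U →ₗ[ℝ] B :=
    { toFun := l
      map_add' := fun x y => tendsto_nhds_unique (hl _) (by
        simpa using (hl x).add (hl y))
      map_smul' := fun r x => tendsto_nhds_unique (hl _) (by
        simpa using (hl x).const_smul r) }
  have hg : ∀ x, ‖g x‖ = ‖x‖ := by
    intro x
    obtain ⟨n, hn⟩ := hU x
    refine tendsto_nhds_unique (hl x).norm (tendsto_iff_dist_tendsto_zero.2 ?_)
    have h0 : Filter.Tendsto (fun n : ℕ => (1 / 2 : ℝ) ^ n * ‖(x : A)‖) Filter.atTop (𝓝 0) := by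
      simpa using (tendsto_pow_atTop_nhds_zero_of_lt_one (r := (1 / 2 : ℝ)) (by norm_num)
        (by norm_num)).mul_const ‖(x : A)‖
    refine squeeze_zero' (Filter.Eventually.of_forall fun _ => dist_nonneg) ?_ h0
    filter_upwards [Filter.eventually_ge_atTop n] with m hm
    exact h1 m x (hX hm hn)
  have hdense : DenseRange U.subtype := by
    have : (⋃ n, (X n : Set A)) ⊆ range U.subtype := by
      rintro x hx
      obtain ⟨n, hn⟩ := mem_iUnion.1 hx
      exact ⟨⟨x, le_iSup X n hn⟩, rfl⟩
    exact hd.mono this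
  -- The pointwise limit is isometric on the dense union `U`, because the distortion tends to `0`,
  -- and so extends to `A`.
  let F := g.extendOfNorm U.subtype
  have hF : ∀ x : U, F x = g x := fun x =>
    LinearMap.extendOfNorm_eq hdense ⟨1, fun x => by rw [hg, one_mul]; rfl⟩ x
  refine ⟨⟨F.toLinearMap, fun x => ?_⟩, fun n x hx => ?_⟩
  · refine hdense.induction_on (p := fun x => ‖F x‖ = ‖x‖) x
      (isClosed_eq F.continuous.norm continuous_norm) fun x => ?_
    change ‖F (x : A)‖ = _
    rw [hF, hg]; rfl
  · have hx' : x ∈ U := le_iSup X n hx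
    have h3 := dist_le_of_le_geometric_of_tendsto₀ (1 / 2) _ (by norm_num) (hstep n x hx)
      ((Filter.tendsto_add_atTop_iff_nat n).2 (hl ⟨x, hx'⟩))
    rw [dist_comm, dist_eq_norm, zero_add] at h3
    change ‖F x - f n x‖ ≤ _
    have h4 : F x = l ⟨x, hx'⟩ := hF ⟨x, hx'⟩
    rw [h4]
    refine h3.trans (le_of_eq ?_)
    ring

theorem abs_norm_map_sub_le_of_mem_bot {A B : Type*} [NormedAddCommGroup A] [NormedSpace ℝ A]
    [NormedAddCommGroup B] [NormedSpace ℝ B] (f : A →ₗ[ℝ] B) (r : ℝ) :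
    ∀ x ∈ (⊥ : Submodule ℝ A), |‖f x‖ - ‖x‖| ≤ r * ‖x‖ := by
  intro x hx
  rw [(Submodule.mem_bot ℝ).1 hx]
  simp

/-- Every separable space embeds in every Gurarij space. -/
theorem IsGurarij.exists_linearIsometry {G X : Type u} [NormedAddCommGroup G] [NormedSpace ℝ G]
    [NormedAddCommGroup X] [NormedSpace ℝ X] [TopologicalSpace.SeparableSpace X]
    (hG : IsGurarij G) : Nonempty (X →ₗᵢ[ℝ] G) := by
  have := hG.1
  let d := TopologicalSpace.denseSeq X
  obtain ⟨s, hs⟩ := exists_seq_of_forall_step (α := Submodule ℝ X × (X →ₗ[ℝ] G))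
    (fun n a => FiniteDimensional ℝ a.1 ∧ ∀ x ∈ a.1, |‖a.2 x‖ - ‖x‖| ≤ (1 / 2) ^ n * ‖x‖)
    (fun n a a' => a.1 ≤ a'.1 ∧ d n ∈ a'.1 ∧
      ∀ x ∈ a.1, ‖a'.2 x - a.2 x‖ ≤ 2 * (1 / 2) ^ n * ‖x‖)
    ⟨(⊥, 0), inferInstanceAs (FiniteDimensional ℝ (⊥ : Submodule ℝ X)),
      abs_norm_map_sub_le_of_mem_bot _ _⟩
    (by
      rintro n ⟨W, f⟩ ⟨hW, hf⟩
      simp only at hW hf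
      -- The new map moves the old one only in proportion to the old defect, while its own defect,
      -- on a larger subspace, is halved.
      obtain ⟨g, hg1, hg2⟩ := hG.exists_almost_isometry W.subtype (f ∘ₗ W.subtype)
        (ε := (1 / 2) ^ n) (by positivity)
        (fun v => by rw [abs_sub_comm]; exact hf v v.2) (W ⊔ Submodule.span ℝ {d n})
        (δ := (1 / 2) ^ (n + 1)) (by positivity) (pow_le_one₀ (by norm_num) (by norm_num))
      exact ⟨(W ⊔ Submodule.span ℝ {d n}, g), ⟨by dsimp only; infer_instance, hg1⟩, le_sup_left,
        Submodule.mem_sup_right (Submodule.mem_span_singleton_self _),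
        fun x hx => hg2 ⟨x, hx⟩⟩)
  obtain ⟨F, -⟩ := exists_linearIsometry_of_approx (fun n => (s n).1)
    (monotone_nat_of_le_succ fun n => (hs n).2.1)
    ((TopologicalSpace.denseRange_denseSeq X).mono (by
      rintro _ ⟨n, rfl⟩
      exact mem_iUnion.2 ⟨n + 1, (hs n).2.2.1⟩))
    (fun n => (s n).2) (fun n => (hs n).1.2) (fun n => (hs n).2.2.2)
  exact ⟨F⟩

/-! ### Uniqueness by back and forth -/

section Uniqueness

variable {G H : Type u} [NormedAddCommGroup G] [NormedSpace ℝ G] [NormedAddCommGroup H]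
  [NormedSpace ℝ H]

/-- The back-and-forth step between two Gurarij spaces. -/
theorem IsGurarij.exists_back_and_forth (hG : IsGurarij G) (hH : IsGurarij H) (W : Submodule ℝ G)
    [FiniteDimensional ℝ W] (f : G →ₗ[ℝ] H) {ε : ℝ} (hε : 0 < ε) (hε1 : ε ≤ 1)
    (hf : ∀ x ∈ W, |‖f x‖ - ‖x‖| ≤ ε * ‖x‖) (x₀ : G) (Y : Submodule ℝ H) [FiniteDimensional ℝ Y] :
    ∃ (W' : Submodule ℝ G) (f' : G →ₗ[ℝ] H), FiniteDimensional ℝ W' ∧ W ≤ W' ∧ x₀ ∈ W' ∧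
      (∀ x ∈ W', |‖f' x‖ - ‖x‖| ≤ ε / 2 * ‖x‖) ∧ (∀ x ∈ W, ‖f' x - f x‖ ≤ 6 * ε * ‖x‖) ∧
      ∀ y ∈ Y, ∃ x ∈ W', ‖x‖ ≤ 2 * ‖y‖ ∧ ‖f' x - y‖ ≤ ε * ‖y‖ := by
  -- `g` goes back, nearly inverting `f` on `W`; the next map `f'` goes forth, nearly inverting `g`.
  -- Adding the image of `g` to the new domain puts vectors near `Y` in the range of `f'`.
  obtain ⟨g, hg1, hg2⟩ := hG.exists_almost_isometry (f ∘ₗ W.subtype) W.subtype hε.le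
    (fun v => hf v v.2) (Y ⊔ W.map f) (δ := ε / 2) (by positivity) (by linarith)
  obtain ⟨f', hf1, hf2⟩ := hH.exists_almost_isometry (g ∘ₗ (Y ⊔ W.map f).subtype)
    (Y ⊔ W.map f).subtype (ε := ε / 2) (by positivity) (fun v => hg1 v v.2)
    (W ⊔ Submodule.span ℝ {x₀} ⊔ (Y ⊔ W.map f).map g) (δ := ε / 2) (by positivity) (by linarith)
  refine ⟨W ⊔ Submodule.span ℝ {x₀} ⊔ (Y ⊔ W.map f).map g, f', inferInstance,
    le_sup_left.trans le_sup_left, Submodule.mem_sup_left (Submodule.mem_sup_right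
      (Submodule.mem_span_singleton_self _)), hf1, fun x hx => ?_, fun y hy => ?_⟩
  · have hfx : f x ∈ Y ⊔ W.map f := Submodule.mem_sup_right ⟨x, hx, rfl⟩
    have h1 : ‖g (f x) - x‖ ≤ 2 * ε * ‖x‖ := hg2 ⟨x, hx⟩
    have h2 : ‖f' (g (f x)) - f x‖ ≤ 2 * (ε / 2) * ‖f x‖ := hf2 ⟨f x, hfx⟩
    have h3 := (abs_le.1 (hf1 (g (f x) - x) (Submodule.sub_mem _
      (Submodule.mem_sup_right ⟨f x, hfx, rfl⟩)
      (Submodule.mem_sup_left (Submodule.mem_sup_left hx))))).2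
    have h4 := (abs_le.1 (hf x hx)).2
    -- The constant `6`: the first part costs `ε‖f x‖ ≤ 2ε‖x‖`, and the second is at most twice `‖g
    -- (f x) - x‖ ≤ 2ε‖x‖`.
    have h5 : f' x - f x = f' (g (f x)) - f x - f' (g (f x) - x) := by rw [map_sub]; abel
    rw [h5]
    refine (norm_sub_le _ _).trans ?_
    have hx0 := norm_nonneg x
    have h6 : ‖f x‖ ≤ 2 * ‖x‖ := by nlinarith
    have h7 : ‖f' (g (f x) - x)‖ ≤ 2 * ‖g (f x) - x‖ := by
      nlinarith [norm_nonneg (g (f x) - x)]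
    nlinarith
  · have hy' : y ∈ Y ⊔ W.map f := Submodule.mem_sup_left hy
    refine ⟨g y, Submodule.mem_sup_right ⟨y, hy', rfl⟩, ?_, ?_⟩
    · have := (abs_le.1 (hg1 y hy')).2
      nlinarith [norm_nonneg y]
    · refine (hf2 ⟨y, hy'⟩).trans (le_of_eq ?_)
      change 2 * (ε / 2) * ‖y‖ = _
      ring

/-- Any two Gurarij spaces are isometrically isomorphic. -/
theorem IsGurarij.nonempty_linearIsometryEquiv (hG : IsGurarij G) (hH : IsGurarij H) :
    Nonempty (G ≃ₗᵢ[ℝ] H) := by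
  have := hG.1
  have := hH.1
  have := hG.2.1
  have := hH.2.1
  let d := TopologicalSpace.denseSeq G
  let e := TopologicalSpace.denseSeq H
  obtain ⟨s, hs⟩ := exists_seq_of_forall_step (α := Submodule ℝ G × (G →ₗ[ℝ] H))
    (fun n a => FiniteDimensional ℝ a.1 ∧ ∀ x ∈ a.1, |‖a.2 x‖ - ‖x‖| ≤ (1 / 2) ^ n * ‖x‖)
    (fun n a a' => a.1 ≤ a'.1 ∧ d n ∈ a'.1 ∧
      (∀ x ∈ a.1, ‖a'.2 x - a.2 x‖ ≤ 6 * (1 / 2) ^ n * ‖x‖) ∧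
      -- Each `e k` is approached at all stages `n ≥ k`, with errors tending to `0`; a single
      -- approximation would not put it in the closed range.
      ∀ k ≤ n, ∃ x ∈ a'.1, ‖x‖ ≤ 2 * ‖e k‖ ∧ ‖a'.2 x - e k‖ ≤ (1 / 2) ^ n * ‖e k‖)
    ⟨(⊥, 0), inferInstanceAs (FiniteDimensional ℝ (⊥ : Submodule ℝ G)),
      abs_norm_map_sub_le_of_mem_bot _ _⟩
    (by
      rintro n ⟨W, f⟩ ⟨hW, hf⟩
      simp only at hW hf
      have := FiniteDimensional.span_of_finite ℝ ((finite_Iic n).image e)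
      obtain ⟨W', f', h1, h2, h3, h4, h5, h6⟩ := hG.exists_back_and_forth hH W f
        (ε := (1 / 2) ^ n) (by positivity) (pow_le_one₀ (by norm_num) (by norm_num)) hf (d n)
        (Submodule.span ℝ (e '' Iic n))
      refine ⟨(W', f'), ⟨h1, fun x hx => ?_⟩, h2, h3, h5, fun k hk => h6 _
        (Submodule.subset_span ⟨k, hk, rfl⟩)⟩
      rw [pow_succ, mul_one_div]
      exact h4 x hx)
  obtain ⟨F, hF⟩ := exists_linearIsometry_of_approx (fun n => (s n).1)
    (monotone_nat_of_le_succ fun n => (hs n).2.1)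
    ((TopologicalSpace.denseRange_denseSeq G).mono (by
      rintro _ ⟨n, rfl⟩
      exact mem_iUnion.2 ⟨n + 1, (hs n).2.2.1⟩))
    (fun n => (s n).2) (fun n => (hs n).1.2) (fun n => (hs n).2.2.2.1)
  have hcl : IsClosed (range F) := F.isometry.isClosedEmbedding.isClosed_range
  have he : range e ⊆ range F := by
    rintro _ ⟨k, rfl⟩
    rw [← hcl.closure_eq, Metric.mem_closure_range_iff]
    intro r hr
    -- The limit map differs from stage `n + 1` by at most `6 * (1 / 2) ^ n * ‖x‖` with `‖x‖ ≤ 2‖e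
    -- k‖`; with the stage error this makes `13`, so `25` is generous.
    have h0 : Filter.Tendsto (fun n : ℕ => (1 / 2 : ℝ) ^ n * (25 * ‖e k‖)) Filter.atTop (𝓝 0) := by
      simpa using (tendsto_pow_atTop_nhds_zero_of_lt_one (r := (1 / 2 : ℝ)) (by norm_num)
        (by norm_num)).mul_const (25 * ‖e k‖)
    obtain ⟨n, hn, hkn⟩ := ((h0.eventually (gt_mem_nhds hr)).and
      (Filter.eventually_ge_atTop k)).exists
    obtain ⟨x, hx, hx1, hx2⟩ := (hs n).2.2.2.2 k hkn
    refine ⟨x, lt_of_le_of_lt ?_ hn⟩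
    have h1 := hF (n + 1) x hx
    rw [dist_comm, dist_eq_norm]
    have h2 : F x - e k = (F x - (s (n + 1)).2 x) + ((s (n + 1)).2 x - e k) := by abel
    rw [h2]
    refine (norm_add_le _ _).trans ?_
    have hp : (0 : ℝ) < (1 / 2) ^ n := by positivity
    rw [pow_succ] at h1
    have h3 := mul_le_mul_of_nonneg_left hx1 hp.le
    have h4 := mul_nonneg hp.le (norm_nonneg (e k))
    linarith
  have hsurj : Function.Surjective F := by
    rw [← range_eq_univ, ← hcl.closure_eq]
    exact ((TopologicalSpace.denseRange_denseSeq H).mono he).closure_eq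
  exact ⟨LinearIsometryEquiv.ofSurjective F hsurj⟩

end Uniqueness

/-! ### Gurarij spaces are the limits of the class of finite-dimensional spaces -/

/-- Over an empty set the relaxation is `∞` everywhere; finite values are what
`strictlyRefines_relax` requires. -/
theorem relax_jointApx_lt_top {X G D : Type u} [NormedAddCommGroup X] [NormedSpace ℝ X]
    [NormedAddCommGroup G] [NormedSpace ℝ G]
    [NormedAddCommGroup D] [NormedSpace ℝ D] (i : X →ₗᵢ[ℝ] D) (j : G →ₗᵢ[ℝ] D) {S : Set (X × G)}
    (hS : S.Nonempty) {ε : ℝ≥0∞} (hε : ε < ∞) (x : X) (y : G) :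
    (relax (jointApx i j) S ε).1 x y < ∞ := by
  obtain ⟨k, hk⟩ := hS
  refine ((relax (jointApx i j) S ε).2.le_add x k.1 y k.2).trans_lt ?_
  refine ENNReal.add_lt_top.2 ⟨ENNReal.add_lt_top.2 ⟨edist_lt_top _ _, ?_⟩, edist_lt_top _ _⟩
  exact (relax_le (jointApx i j) ε hk).trans_lt (ENNReal.add_lt_top.2 ⟨edist_lt_top _ _, hε⟩)

section Limit

variable {G : Type u} [NormedAddCommGroup G] [NormedSpace ℝ G] [CompleteSpace G]

/-- `F` and `G` are amalgamated along the given isometry, and the joint distance is relaxed at the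
pairs to be preserved. A refinement that is total on the basis dominates another joint distance, in
which every basis vector of `F` is close to some vector of `G`. -/
theorem isGurarij_of_isFraisseLimit (h : IsFraisseLimit finDimBanach.{u} (banachStructure G)) :
    IsGurarij G := by
  have : TopologicalSpace.SeparableSpace G := h.separable
  refine isGurarij_of_approx fun n m F _ _ _ b g hbg η hη => ?_
  have : CompleteSpace F := FiniteDimensional.complete ℝ F
  obtain ⟨D, _, _, i, j, hij, -⟩ := exists_amalgam (ε := 0)
    (Fintype.linearCombination ℝ (fun k => b (Sum.inl k))) (Fintype.linearCombination ℝ g) le_rfl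
    (fun s => by simp [Fintype.linearCombination_apply, hbg])
  have hij' : ∀ k, i (b (Sum.inl k)) = j (g k) := fun k => by
    have := hij (Pi.single k 1)
    rw [Fintype.linearCombination_apply_single, Fintype.linearCombination_apply_single, one_smul,
      one_smul, zero_mul] at this
    exact sub_eq_zero.1 (norm_le_zero_iff.1 this)
  let N : ℝ := Fintype.card (Fin n ⊕ Fin m)
  have hN : 0 ≤ N := Nat.cast_nonneg _
  let r : ℝ := η / (2 * (N + 1))
  have hr : 0 < r := by positivity
  have hr' : (0 : ℝ≥0∞) < ENNReal.ofReal r := ENNReal.ofReal_pos.2 hr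
  let S : Set (F × G) := range fun k => (b (Sum.inl k), g k)
  obtain ⟨φ, hφ, hφψ, htot⟩ := h.exists_total (banachStructure F) (isKStructure_banachStructure F)
    (range b) (finite_range b) _ (relax_mem_stx i j (S := S) (finite_range _) hr') r hr
  obtain ⟨D', _, _, i', j', hD'⟩ := exists_jointApx_le_of_mem_stx (X := F) (Y := G) hφ
  have hD' := Apx.le_iff.1 hD'
  have hle := Apx.le_iff.1 (StrictlyRefines.le (X := F) (Y := G) hφψ)
  have h1 : ∀ k, ∃ y : G, φ.1 (b k) y < ENNReal.ofReal (2 * r) := fun k =>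
    htot (b k) ⟨k, rfl⟩ _ (ENNReal.ofReal_lt_ofReal_iff (by positivity)|>.2 (by linarith))
  choose y hy using h1
  -- The vectors `g` are kept, since refining the relaxation keeps them within `r`; totality only
  -- supplies the remaining ones, within `2 * r`. Over `N` vectors the error is at most `2 * r * N ≤
  -- η`.
  refine ⟨Sum.elim g (y ∘ Sum.inr), fun k => by simpa using hη.le, fun s => ?_⟩
  have key := abs_norm_sum_sub_norm_sum_le j' i' (x := Sum.elim g (y ∘ Sum.inr)) (y := b)
    (r := 2 * r) (by positivity) (by
      rintro (k | k)
      · have h2 : edist (i' (b (Sum.inl k))) (j' (g k)) ≤ ENNReal.ofReal r := by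
          refine (hD' _ _).trans ((hle _ _).trans ?_)
          refine (relax_le (jointApx i j) _ (mem_range_self k)).trans ?_
          have : (jointApx i j).1 (b (Sum.inl k)) (g k) = 0 := by
            change edist (i (b (Sum.inl k))) (j (g k)) = 0
            rw [hij', edist_self]
          rw [this, zero_add]
        rw [edist_comm, edist_dist, ENNReal.ofReal_le_ofReal_iff hr.le, dist_eq_norm] at h2
        exact h2.trans (by linarith)
      · have h2 := (hD' _ _).trans_lt (hy (Sum.inr k))
        have h2 : edist (i' (b (Sum.inr k))) (j' (y (Sum.inr k))) < ENNReal.ofReal (2 * r) := h2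
        rw [edist_comm, edist_lt_ofReal, dist_eq_norm] at h2
        exact h2.le) s
  refine key.trans ?_
  rw [← mul_assoc]
  refine mul_le_mul_of_nonneg_right ?_ (norm_nonneg s)
  change 2 * (η / (2 * (N + 1))) * N ≤ η
  rw [mul_div_assoc', div_mul_eq_mul_div, div_le_iff₀ (by positivity)]
  nlinarith

/-- Let `ψ` lie above a relaxed joint distance through `i, j`. An almost retraction `φ : D → G`
fixing the second entries of `S` makes `x ↦ φ (i x)` almost isometric on a finite-dimensional space.
Amalgamating `X` and `G` along it places each required `x` near the point `φ (i x)` of `G`, and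
almost preserves the distances on `S`. -/
theorem IsGurarij.exists_total (hG : IsGurarij G) {X : Type u} [NormedAddCommGroup X]
    [NormedSpace ℝ X] [CompleteSpace X] {A₀ : Set X} (hA₀ : A₀.Finite) {ψ : Apx X G}
    (hψ : ψ ∈ Stx finDimBanach (banachStructure X) (banachStructure G)) {ε : ℝ} (hε : 0 < ε) :
    ∃ φ : Apx X G, φ ∈ Stx finDimBanach (banachStructure X) (banachStructure G) ∧
      StrictlyRefines φ ψ ∧ IsTotalOn ε A₀ φ := by
  obtain ⟨D, _, _, i, j, S, ε', hS, hε', hε'', hSψ⟩ := exists_relax_le_of_mem_stx hψ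
  lift ε' to NNReal using hε''.ne
  have hε' : 0 < (ε' : ℝ) := by exact_mod_cast hε'
  -- The point `0` makes `B` nonempty, which gives `0 ≤ M` and finite values for the new relaxation.
  let B : Set X := insert 0 (A₀ ∪ Prod.fst '' S)
  have hB : B.Finite := (hA₀.union (hS.image _)).insert 0
  obtain ⟨M₁, hM₁⟩ := (hB.image norm).bddAbove
  obtain ⟨M₂, hM₂⟩ := (hS.image fun k => ‖i k.1 - j k.2‖).bddAbove
  have hM₁ : ∀ x ∈ B, ‖x‖ ≤ M₁ := fun x hx => hM₁ (mem_image_of_mem _ hx)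
  have hM₂ : ∀ k ∈ S, ‖i k.1 - j k.2‖ ≤ M₂ := fun k hk =>
    hM₂ (mem_image_of_mem (fun k : X × G => ‖i k.1 - j k.2‖) hk)
  let M := max M₁ M₂
  have hM : 0 ≤ M := (norm_nonneg 0).trans ((hM₁ 0 (mem_insert _ _)).trans (le_max_left _ _))
  -- Four errors `c` must fit in `ε'`: the amalgam, the relaxation at the graph, the distortion of
  -- `φ`, and the second relaxation giving strictness. Totality uses the first two.
  let c : ℝ := min ε ε' / 4
  have hc : 0 < c := by positivity
  have hc1 : 4 * c ≤ ε := by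
    have := min_le_left ε (ε' : ℝ)
    simp only [c]; linarith
  have hc2 : 4 * c ≤ ε' := by
    have := min_le_right ε (ε' : ℝ)
    simp only [c]; linarith
  let δ : ℝ := c / (M + 1)
  have hδ : 0 < δ := by positivity
  have hδM : ∀ t ≤ M, δ * t ≤ c := fun t ht => by
    refine (mul_le_mul_of_nonneg_left ht hδ.le).trans ?_
    simp only [δ]
    rw [div_mul_eq_mul_div, div_le_iff₀ (by positivity)]
    nlinarith
  have := FiniteDimensional.span_of_finite ℝ hB
  have := FiniteDimensional.span_of_finite ℝ (hS.image Prod.snd)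
  obtain ⟨φ, h1, h2⟩ := hG.exists_retract j ((Submodule.span ℝ B).map i.toLinearMap ⊔
    (Submodule.span ℝ (Prod.snd '' S)).map j.toLinearMap) (Submodule.span ℝ (Prod.snd '' S)) hδ
  have hiB : ∀ x ∈ Submodule.span ℝ B, i x ∈ (Submodule.span ℝ B).map i.toLinearMap ⊔
    (Submodule.span ℝ (Prod.snd '' S)).map j.toLinearMap := fun x hx =>
      Submodule.mem_sup_left ⟨x, hx, rfl⟩
  obtain ⟨D', _, _, i', j', hij', -⟩ := exists_amalgam (Submodule.span ℝ B).subtype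
    (φ ∘ₗ i.toLinearMap ∘ₗ (Submodule.span ℝ B).subtype) hδ.le (fun v => by
      have := h2 _ (hiB v v.2)
      rw [i.norm_map, abs_sub_comm] at this
      exact this)
  have hij'' : ∀ x ∈ B, edist (i' x) (j' (φ (i x))) ≤ ENNReal.ofReal c := fun x hx => by
    rw [edist_dist, dist_eq_norm]
    exact ENNReal.ofReal_le_ofReal ((hij' ⟨x, Submodule.subset_span hx⟩).trans
      (hδM _ ((hM₁ x hx).trans (le_max_left _ _))))
  have hc' : 0 < ENNReal.ofReal c := ENNReal.ofReal_pos.2 hc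
  let S' : Set (X × G) := (fun x => (x, φ (i x))) '' B
  have hS' : ∀ x ∈ B, (relax (jointApx i' j') S' (ENNReal.ofReal c)).1 x (φ (i x)) ≤
      ENNReal.ofReal (2 * c) := fun x hx => by
    refine (relax_le (jointApx i' j') (S := S') _
      (mem_image_of_mem (fun x => (x, φ (i x))) hx)).trans ?_
    rw [two_mul, ENNReal.ofReal_add hc.le hc.le]
    exact add_le_add (hij'' x hx) le_rfl
  refine ⟨relax (jointApx i' j') S' (ENNReal.ofReal c), relax_mem_stx i' j' (hB.image _) hc', ?_,
    fun x hx s hs => ⟨φ (i x), ?_⟩⟩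
  · refine (strictlyRefines_relax (relax_jointApx_lt_top i' j' ((insert_nonempty _ _).image _)
      ENNReal.ofReal_lt_top) hS hc').mono ((relax_le_relax fun k hk => ?_).trans hSψ)
    have hkB : k.1 ∈ B := mem_insert_of_mem _ (Or.inr ⟨k, hk, rfl⟩)
    have hk2 : k.2 ∈ Submodule.span ℝ (Prod.snd '' S) := Submodule.subset_span ⟨k, hk, rfl⟩
    have h3 : dist (φ (i k.1)) k.2 ≤ dist (i k.1) (j k.2) + c := by
      have := h2 (i k.1 - j k.2) (Submodule.sub_mem _ (hiB _ (Submodule.subset_span hkB))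
        (Submodule.mem_sup_right ⟨k.2, hk2, rfl⟩))
      rw [map_sub, h1 _ hk2] at this
      rw [dist_eq_norm, dist_eq_norm]
      have h4 := hδM _ ((hM₂ k hk).trans (le_max_right _ _))
      linarith [(abs_le.1 this).2]
    have h4 : (relax (jointApx i' j') S' (ENNReal.ofReal c)).1 k.1 k.2 ≤
        ENNReal.ofReal (2 * c) + ENNReal.ofReal (dist (i k.1) (j k.2) + c) := by
      refine ((relax (jointApx i' j') S' (ENNReal.ofReal c)).2.le_add k.1 k.1 k.2
        (φ (i k.1))).trans ?_
      rw [edist_self, zero_add, edist_dist]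
      exact add_le_add (hS' _ hkB) (ENNReal.ofReal_le_ofReal h3)
    refine (add_le_add h4 le_rfl).trans ?_
    change _ ≤ edist (i k.1) (j k.2) + (ε' : ℝ≥0∞)
    rw [edist_dist, ← ENNReal.ofReal_coe_nnreal, ← ENNReal.ofReal_add (by positivity)
      (by positivity), ← ENNReal.ofReal_add (by positivity) (by positivity),
      ← ENNReal.ofReal_add (by positivity) (by positivity)]
    exact ENNReal.ofReal_le_ofReal (by linarith)
  · exact ((hS' x (mem_insert_of_mem _ (Or.inl hx))).trans
      (ENNReal.ofReal_le_ofReal (by linarith))).trans_lt hs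

theorem isGurarij_iff_isFraisseLimit :
    IsGurarij G ↔ IsFraisseLimit finDimBanach.{u} (banachStructure G) := by
  refine ⟨fun hG => ⟨hG.2.1, isKStructure_banachStructure G, fun A hA A₀ hA₀ ψ hψ ε hε => ?_⟩,
    isGurarij_of_isFraisseLimit⟩
  obtain ⟨X, _, _, _, rfl⟩ := isKStructure_iff.1 hA
  exact hG.exists_total (X := X) hA₀ hψ hε

end Limit

/-! ### Existence of a Gurarij space -/

/-- The `ℓ¹`-norm of a finitely supported sequence. -/
def sumAbs (v : ℕ →₀ ℝ) : ℝ := v.sum fun _ c => |c|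

/-- The seminorms on finitely supported sequences which are dominated by the `ℓ¹`-norm. -/
def boundedSeminorms : Set ((ℕ →₀ ℝ) → ℝ) :=
  {p | (∀ x y, p (x + y) ≤ p x + p y) ∧ (∀ (c : ℝ) x, p (c • x) = |c| * p x) ∧
    ∀ v, p v ≤ sumAbs v}

/-- A member of `boundedSeminorms`, as a seminorm. -/
noncomputable def toSeminorm (p : boundedSeminorms) : Seminorm ℝ (ℕ →₀ ℝ) :=
  Seminorm.of p.1 p.2.1 p.2.2.1

theorem toSeminorm_apply (p : boundedSeminorms) (v : ℕ →₀ ℝ) : toSeminorm p v = p.1 v := rfl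

/-- A closed subset of a product of intervals, by the `ℓ¹` bound; compactness later provides the
Baire property. -/
theorem isCompact_boundedSeminorms : IsCompact boundedSeminorms := by
  refine (isCompact_univ_pi fun v : ℕ →₀ ℝ =>
    isCompact_Icc (a := 0) (b := sumAbs v)).of_isClosed_subset
    ?_ fun p hp v _ => ⟨apply_nonneg (toSeminorm ⟨p, hp⟩) v, hp.2.2 v⟩
  simp only [boundedSeminorms, ofPred_and, ofPred_forall]
  refine IsClosed.inter (isClosed_iInter fun x => isClosed_iInter fun y => isClosed_le
    (by fun_prop) (by fun_prop)) (IsClosed.inter (isClosed_iInter fun x => isClosed_iInter fun y =>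
      isClosed_eq (by fun_prop) (by fun_prop)) (isClosed_iInter fun v => isClosed_le
        (by fun_prop) (by fun_prop)))

instance : CompactSpace boundedSeminorms :=
  isCompact_iff_compactSpace.1 isCompact_boundedSeminorms

theorem norm_linearCombination_mem {D : Type*} [NormedAddCommGroup D] [NormedSpace ℝ D]
    {w : ℕ → D} (hw : ∀ i, ‖w i‖ ≤ 1) :
    (fun v => ‖Finsupp.linearCombination ℝ w v‖) ∈ boundedSeminorms := by
  refine ⟨fun x y => by dsimp only; rw [map_add]; exact norm_add_le _ _, fun c x => by
    dsimp only; rw [map_smul, norm_smul, Real.norm_eq_abs], fun v => ?_⟩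
  dsimp only
  rw [Finsupp.linearCombination_apply]
  refine norm_sum_le_of_le _ fun i _ => ?_
  rw [norm_smul, Real.norm_eq_abs]
  exact mul_le_of_le_one_right (abs_nonneg _) (hw i)

theorem toSeminorm_single_le (p : boundedSeminorms) (i : ℕ) (c : ℝ) :
    toSeminorm p (Finsupp.single i c) ≤ |c| := by
  refine (p.2.2.2 _).trans (le_of_eq ?_)
  rw [sumAbs, Finsupp.sum_single_index abs_zero]

/-- Evaluation is Lipschitz in the coefficients uniformly in the seminorm, by `ℓ¹` domination; this
upgrades pointwise to joint continuity. -/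
theorem continuous_eval_linearCombination {ι : Type*} [Fintype ι] (z : ι → ℕ →₀ ℝ) :
    Continuous fun a : boundedSeminorms × (ι → ℝ) => a.1.1 (∑ k, a.2 k • z k) := by
  rw [continuous_iff_continuousAt]
  rintro ⟨p₀, s₀⟩
  refine tendsto_iff_dist_tendsto_zero.2 (squeeze_zero (fun _ => dist_nonneg)
    (g := fun a : boundedSeminorms × (ι → ℝ) => ∑ k, |a.2 k - s₀ k| * sumAbs (z k) +
      |a.1.1 (∑ k, s₀ k • z k) - p₀.1 (∑ k, s₀ k • z k)|) (fun a => ?_) ?_)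
  · refine (dist_triangle _ (a.1.1 (∑ k, s₀ k • z k)) _).trans (add_le_add ?_ le_rfl)
    refine (abs_sub_map_le_sub (toSeminorm a.1) _ _).trans ?_
    rw [← Finset.sum_sub_distrib]
    refine (Finset.le_sum_of_subadditive (toSeminorm a.1) (map_zero _).le (map_add_le_add _) _
      _).trans (Finset.sum_le_sum fun k _ => ?_)
    rw [← sub_smul, map_smul_eq_mul, Real.norm_eq_abs]
    exact mul_le_mul_of_nonneg_left (a.1.2.2.2 _) (abs_nonneg _)
  · have hc : Continuous fun a : boundedSeminorms × (ι → ℝ) =>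
        ∑ k, |a.2 k - s₀ k| * sumAbs (z k) +
          |a.1.1 (∑ k, s₀ k • z k) - p₀.1 (∑ k, s₀ k • z k)| := by
      have : Continuous fun a : boundedSeminorms × (ι → ℝ) => a.1.1 (∑ k, s₀ k • z k) :=
        (continuous_apply _).comp (continuous_subtype_val.comp continuous_fst)
      fun_prop
    have := hc.tendsto (p₀, s₀)
    simpa using this

/-! ### Extension tasks as open dense sets of seminorms -/

section Tasks

variable {n m : ℕ}

/-- The seminorms which either do not almost extend, on `u`, to the seminorm `N`, or for which an
approximate copy of `N` extending `u` exists. -/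
def extensionSet (u : Fin n → ℕ →₀ ℝ) (N : Seminorm ℝ (Fin n ⊕ Fin m → ℝ)) (ε : ℝ) :
    Set boundedSeminorms :=
  {p | ∃ s : Fin n → ℝ, ε * ‖s‖ <
    |p.1 (∑ k, s k • u k) - N (∑ k, s k • Pi.single (Sum.inl k) 1)|} ∪
  {p | ∃ w : Fin m → ℕ →₀ ℝ, ∀ s ∈ Metric.closedBall (0 : Fin n ⊕ Fin m → ℝ) 1,
    |p.1 (∑ k, s k • Sum.elim u w k) - N s| < 2 * ε}

/-- For the second alternative, the bad pairs of a seminorm and a point of the compact ball form a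
closed set, whose projection is closed. -/
theorem isOpen_extensionSet (u : Fin n → ℕ →₀ ℝ) (N : Seminorm ℝ (Fin n ⊕ Fin m → ℝ)) (ε : ℝ) :
    IsOpen (extensionSet u N ε) := by
  refine IsOpen.union ?_ ?_
  · simp only [ofPred_exists]
    refine isOpen_iUnion fun s => isOpen_lt continuous_const ?_
    have : Continuous fun p : boundedSeminorms => p.1 (∑ k, s k • u k) :=
      (continuous_apply _).comp continuous_subtype_val
    exact (this.sub continuous_const).abs
  · simp only [ofPred_exists]
    refine isOpen_iUnion fun w => ?_
    let K := Metric.closedBall (0 : Fin n ⊕ Fin m → ℝ) 1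
    have : CompactSpace K := isCompact_iff_compactSpace.1 (isCompact_closedBall _ _)
    have hcl : IsClosed {a : boundedSeminorms × K |
        2 * ε ≤ |a.1.1 (∑ k, a.2.1 k • Sum.elim u w k) - N a.2|} := by
      refine isClosed_le continuous_const (Continuous.abs (Continuous.sub ?_ ?_))
      · exact (continuous_eval_linearCombination (Sum.elim u w)).comp
          (continuous_fst.prodMk (continuous_subtype_val.comp continuous_snd))
      · exact (Seminorm.continuous_pi N).comp (continuous_subtype_val.comp continuous_snd)
    have := (isClosedMap_fst_of_compactSpace _ hcl).isOpen_compl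
    convert this using 1
    ext p
    simp only [mem_ofPred_eq, mem_compl_iff, mem_image, Prod.exists, not_exists, not_and]
    constructor
    · rintro h q s hs rfl
      exact absurd (h s.1 s.2) (not_lt.2 hs)
    · intro h s hs
      by_contra hlt
      exact h p ⟨s, hs⟩ (not_lt.1 hlt) rfl

/-- The vectors of `I` and `u` use only coordinates below some `K`. The spaces of `p` and `N` are
amalgamated; coordinates below `K` keep their meaning, while the next `m` unused ones are redefined
as the missing vectors. -/
theorem exists_mem_extensionSet (u : Fin n → ℕ →₀ ℝ) (N : Seminorm ℝ (Fin n ⊕ Fin m → ℝ)) {ε : ℝ}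
    (hε : 0 < ε) (p : boundedSeminorms) (I : Finset (ℕ →₀ ℝ))
    (hp : ∀ s : Fin n → ℝ, |p.1 (∑ k, s k • u k) - N (∑ k, s k • Pi.single (Sum.inl k) 1)| ≤
      ε * ‖s‖) :
    ∃ q ∈ extensionSet u N ε, ∀ v ∈ I, q.1 v = p.1 v := by
  obtain ⟨X, _, _, π, -, hπ⟩ := exists_normed_of_seminorm (toSeminorm p)
  obtain ⟨F, _, _, ρ, -, hρ⟩ := exists_normed_of_seminorm N
  let b : Fin n ⊕ Fin m → F := fun k => ρ (Pi.single k 1)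
  have hb : ∀ s, ρ s = ∑ k, s k • b k := fun s => by
    have : ρ = Fintype.linearCombination ℝ b :=
      LinearMap.pi_ext' fun k => LinearMap.ext_ring (by simp [b])
    rw [this, Fintype.linearCombination_apply]
  obtain ⟨D, _, _, i, j, hij, -⟩ := exists_amalgam (Fintype.linearCombination ℝ fun k => π (u k))
    (Fintype.linearCombination ℝ fun k => b (Sum.inl k)) hε.le (fun s => by
      have := hp s
      rw [← toSeminorm_apply, ← hπ, ← hρ] at this
      simpa [Fintype.linearCombination_apply, b] using this)
  obtain ⟨K, hK⟩ := ((I ∪ Finset.univ.image u).biUnion Finsupp.support).exists_nat_subset_range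
  have hKI : ∀ v ∈ I ∪ Finset.univ.image u, ∀ a ∈ v.support, a < K := fun v hv a ha =>
    Finset.mem_range.1 (hK (Finset.mem_biUnion.2 ⟨v, hv, ha⟩))
  -- Dividing by `c` keeps the new seminorm below the `ℓ¹`-norm; the factor is restored in the
  -- vectors witnessing the extension.
  let c : ℝ := 1 + ∑ k, ‖b k‖
  have hc : 0 < c := by positivity
  have hbc : ∀ k, ‖b k‖ ≤ c := fun k =>
    (Finset.single_le_sum (f := fun k => ‖b k‖) (fun _ _ => norm_nonneg _)
      (Finset.mem_univ k)).trans (by simp [c])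
  let w : ℕ → D := fun a => if a < K then i (π (Finsupp.single a 1)) else
    if h : a - K < m then c⁻¹ • j (b (Sum.inr ⟨a - K, h⟩)) else 0
  have hw : ∀ a, ‖w a‖ ≤ 1 := by
    intro a
    simp only [w]
    split_ifs with h1 h2
    · rw [i.norm_map, hπ]
      simpa using toSeminorm_single_le p a 1
    · rw [norm_smul, j.norm_map, norm_inv, Real.norm_of_nonneg hc.le, inv_mul_le_iff₀ hc, mul_one]
      exact hbc _
    · simp
  let L := Finsupp.linearCombination ℝ w
  have hL : ∀ v ∈ I ∪ Finset.univ.image u, L v = i (π v) := by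
    intro v hv
    have h1 : i.toLinearMap ∘ₗ π =
        Finsupp.linearCombination ℝ fun a => i (π (Finsupp.single a 1)) := by
      ext a; simp
    have h2 : i (π v) = (i.toLinearMap ∘ₗ π) v := rfl
    rw [h2, h1, Finsupp.linearCombination_apply, Finsupp.linearCombination_apply]
    exact Finsupp.sum_congr fun a ha => by simp [w, hKI v hv a ha]
  have hLw : ∀ l : Fin m, L (c • Finsupp.single (K + l) 1) = j (b (Sum.inr l)) := fun l => by
    rw [map_smul, Finsupp.linearCombination_single, one_smul]
    simp [w, hc.ne']
  refine ⟨⟨_, norm_linearCombination_mem hw⟩, Or.inr ⟨fun l => c • Finsupp.single (K + l) 1,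
    fun s hs => ?_⟩, fun v hv => ?_⟩
  · have h1 : L (∑ k, s k • Sum.elim u (fun l : Fin m => c • Finsupp.single (K + l) 1) k) =
        ∑ k, s (Sum.inl k) • i (π (u k)) + ∑ l, s (Sum.inr l) • j (b (Sum.inr l)) := by
      rw [Fintype.sum_sum_type, map_add, map_sum, map_sum]
      congr 1
      · exact Finset.sum_congr rfl fun k _ => by rw [map_smul, Sum.elim_inl, hL _ (by simp)]
      · exact Finset.sum_congr rfl fun l _ => by rw [map_smul, Sum.elim_inr, hLw]
    change |‖L _‖ - N s| < _
    rw [h1, ← hρ, ← j.norm_map (ρ s), hb, Fintype.sum_sum_type, map_add, map_sum, map_sum]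
    simp only [map_smul]
    refine (abs_norm_sub_norm_le _ _).trans_lt ?_
    rw [add_sub_add_right_eq_sub]
    have h2 := hij fun k => s (Sum.inl k)
    simp only [Fintype.linearCombination_apply, map_sum, map_smul] at h2
    have h3 : ‖fun k => s (Sum.inl k)‖ ≤ 1 := (pi_norm_le_iff_of_nonneg zero_le_one).2 fun k =>
      (norm_le_pi_norm s _).trans (by simpa using hs)
    nlinarith
  · change ‖L v‖ = _
    rw [hL v (Finset.mem_union_left _ hv), i.norm_map, hπ, toSeminorm_apply]

/-- A seminorm outside the first alternative is a limit of members of the second which agree with it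
on larger and larger finite sets. -/
theorem dense_extensionSet (u : Fin n → ℕ →₀ ℝ) (N : Seminorm ℝ (Fin n ⊕ Fin m → ℝ)) {ε : ℝ}
    (hε : 0 < ε) : Dense (extensionSet u N ε) := by
  intro p
  by_cases hp : ∃ s : Fin n → ℝ, ε * ‖s‖ <
      |p.1 (∑ k, s k • u k) - N (∑ k, s k • Pi.single (Sum.inl k) 1)|
  · exact subset_closure (Or.inl hp)
  · push Not at hp
    choose q hq hqI using fun I => exists_mem_extensionSet u N hε p I hp
    refine mem_closure_of_tendsto (f := q) (b := Filter.atTop) ?_ (Filter.Eventually.of_forall hq)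
    rw [tendsto_subtype_rng, tendsto_pi_nhds]
    intro v
    refine tendsto_const_nhds.congr' ?_
    filter_upwards [Filter.eventually_ge_atTop ({v} : Finset (ℕ →₀ ℝ))] with I hI
    exact (hqI I v (hI (by simp))).symm

end Tasks

/-- The real sequence underlying a rational one. -/
noncomputable def ratSeq (q : ℕ →₀ ℚ) : ℕ →₀ ℝ :=
  Finsupp.mapRange (fun c : ℚ => (c : ℝ)) Rat.cast_zero q

theorem exists_ratSeq_near (p : boundedSeminorms) (v : ℕ →₀ ℝ) :
    ∀ η : ℝ, 0 < η → ∃ q, toSeminorm p (v - ratSeq q) < η := by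
  induction v using Finsupp.induction_linear with
  | zero => exact fun η hη => ⟨0, by simpa [ratSeq] using hη⟩
  | add v w hv hw =>
    intro η hη
    obtain ⟨q, hq⟩ := hv (η / 2) (by positivity)
    obtain ⟨r, hr⟩ := hw (η / 2) (by positivity)
    refine ⟨q + r, ?_⟩
    have : v + w - ratSeq (q + r) = (v - ratSeq q) + (w - ratSeq r) := by
      rw [ratSeq, Finsupp.mapRange_add (f := fun c : ℚ => (c : ℝ)) (fun x y => Rat.cast_add x y),
        ← ratSeq, ← ratSeq]
      abel
    rw [this]
    exact (map_add_le_add _ _ _).trans_lt (by linarith)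
  | single i c =>
    intro η hη
    obtain ⟨r, hr1, hr2⟩ := exists_rat_btwn (show c - η < c by linarith)
    refine ⟨Finsupp.single i r, ?_⟩
    rw [ratSeq, Finsupp.mapRange_single, ← Finsupp.single_sub]
    refine (toSeminorm_single_le p i _).trans_lt ?_
    rw [abs_lt]
    constructor <;> linarith

/-- Rational vectors, a countable dense set of seminorms `N'` and the tolerances `1 / (l + 1)` leave
countably many tasks, to which the Baire theorem applies. -/
theorem exists_generic_seminorm : ∃ p : boundedSeminorms, ∀ (n m : ℕ) (u : Fin n → ℕ →₀ ℚ)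
    (N : Seminorm ℝ (Fin n ⊕ Fin m → ℝ)) (l : ℕ), ∃ N' : Seminorm ℝ (Fin n ⊕ Fin m → ℝ),
      (∀ s, |N s - N' s| ≤ 1 / (l + 1) / (n + 1) * ‖s‖) ∧
      p ∈ extensionSet (fun k => ratSeq (u k)) N' (1 / (l + 1)) := by
  choose Q hQc hQ using fun n m : ℕ =>
    exists_countable_dense_seminorm (id : Seminorm ℝ (Fin n ⊕ Fin m → ℝ) → _)
  have : ∀ n m, Countable (Q n m) := fun n m => (hQc n m).to_subtype
  have : Nonempty boundedSeminorms :=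
    ⟨⟨_, norm_linearCombination_mem (w := fun _ : ℕ => (0 : ℝ)) (by simp)⟩⟩
  obtain ⟨p, hp⟩ := (dense_iInter_of_isOpen
    (fun a : Σ n m : ℕ, (Fin n → ℕ →₀ ℚ) × Q n m × ℕ =>
      isOpen_extensionSet (fun k => ratSeq (a.2.2.1 k)) a.2.2.2.1.1 (1 / (a.2.2.2.2 + 1)))
    fun a => dense_extensionSet _ _ (by positivity)).nonempty
  refine ⟨p, fun n m u N l => ?_⟩
  obtain ⟨N', hN', h⟩ := hQ n m N (1 / (l + 1) / (n + 1)) (by positivity)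
  exact ⟨N', h, mem_iInter.1 hp ⟨n, m, u, ⟨N', hN'⟩, l⟩⟩

theorem exists_isGurarij : ∃ (G : Type u) (_ : NormedAddCommGroup G) (_ : NormedSpace ℝ G),
    IsGurarij G := by
  obtain ⟨p, hp⟩ := exists_generic_seminorm
  obtain ⟨X, _, _, π, hπs, hπ⟩ := exists_normed_of_seminorm ((toSeminorm p).comp
    (ULift.moduleEquiv : ULift.{u} (ℕ →₀ ℝ) ≃ₗ[ℝ] (ℕ →₀ ℝ)).toLinearMap)
  let κ : (ℕ →₀ ℝ) →ₗ[ℝ] UniformSpace.Completion X :=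
    (UniformSpace.Completion.toComplₗᵢ (𝕜 := ℝ)).toLinearMap ∘ₗ π ∘ₗ
      (ULift.moduleEquiv : ULift.{u} (ℕ →₀ ℝ) ≃ₗ[ℝ] (ℕ →₀ ℝ)).symm.toLinearMap
  have hκ : ∀ v, ‖κ v‖ = p.1 v := fun v => by
    change ‖((π (ULift.up v) : X) : UniformSpace.Completion X)‖ = _
    rw [UniformSpace.Completion.norm_coe, hπ]
    rfl
  have hdense : ∀ (x : UniformSpace.Completion X) (η : ℝ), 0 < η →
      ∃ q : ℕ →₀ ℚ, ‖κ (ratSeq q) - x‖ < η := by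
    intro x η hη
    obtain ⟨y, hy⟩ := UniformSpace.Completion.denseRange_coe.exists_dist_lt x (half_pos hη)
    obtain ⟨⟨v⟩, rfl⟩ := hπs y
    obtain ⟨q, hq⟩ := exists_ratSeq_near p v (η / 2) (half_pos hη)
    refine ⟨q, ?_⟩
    have h1 : ‖κ v - κ (ratSeq q)‖ < η / 2 := by rw [← map_sub, hκ]; exact hq
    have h2 : ‖x - κ v‖ < η / 2 := by rw [← dist_eq_norm]; exact hy
    rw [← norm_neg]
    calc ‖-(κ (ratSeq q) - x)‖ = ‖(x - κ v) + (κ v - κ (ratSeq q))‖ := by congr 1; abel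
      _ ≤ _ := norm_add_le _ _
      _ < η := by linarith
  have : TopologicalSpace.SeparableSpace (UniformSpace.Completion X) :=
    ⟨range fun q => κ (ratSeq q), countable_range _, Metric.dense_iff.2 fun x η hη => by
      obtain ⟨q, hq⟩ := hdense x η hη
      exact ⟨_, by rwa [Metric.mem_ball, dist_eq_norm], q, rfl⟩⟩
  refine ⟨UniformSpace.Completion X, inferInstance, inferInstance, isGurarij_of_approx ?_⟩
  intro n m F _ _ _ b g hg η hη
  -- The final error is `2ε` from the task and at most `ε` from replacing `N` by `N'`, hence a third
  -- of `η`.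
  obtain ⟨l, hl⟩ := exists_nat_one_div_lt (div_pos hη (zero_lt_three' ℝ))
  obtain ⟨ε, hεdef⟩ : ∃ ε : ℝ, ε = 1 / (l + 1) := ⟨_, rfl⟩
  have hε₀ : 0 < ε / (n + 1) := by rw [hεdef]; positivity
  have hε₁ : ε / (n + 1) * (n + 1) = ε := by field_simp
  choose u hu using fun k => hdense (g k) _ hε₀
  let N : Seminorm ℝ (Fin n ⊕ Fin m → ℝ) := (normSeminorm ℝ F).comp (Fintype.linearCombination ℝ b)
  have hN : ∀ s, N s = ‖∑ k, s k • b k‖ := fun s => by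
    rw [← Fintype.linearCombination_apply]; rfl
  obtain ⟨N', hNN', h⟩ := hp n m u N l
  rw [← hεdef] at h hNN' hl
  have hle : ε / (n + 1) ≤ ε := by
    have : (0 : ℝ) ≤ n := n.cast_nonneg
    nlinarith
  have hpκ : ∀ {ι : Type} [Fintype ι] (s : ι → ℝ) (z : ι → ℕ →₀ ℝ),
      p.1 (∑ k, s k • z k) = ‖∑ k, s k • κ (z k)‖ := fun s z => by
    rw [← hκ, map_sum]; simp only [map_smul]
  obtain ⟨s, hs⟩ | ⟨w, hw⟩ := h
  -- The first alternative fails: approximating the `n` vectors `g` costs `n * ε / (n + 1)` and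
  -- approximating `N` costs `ε / (n + 1)`, in total exactly `ε` times `‖s‖`.
  · exfalso
    have h1 := abs_norm_sum_sub_norm_sum_le (x := fun k => κ (ratSeq (u k))) (y := g)
      LinearIsometry.id LinearIsometry.id hε₀.le
      (fun k => (hu k).le) s
    have h2 := hNN' (∑ k, s k • Pi.single (Sum.inl k) 1)
    have h3 : N (∑ k, s k • Pi.single (Sum.inl k) 1) = ‖∑ k, s k • g k‖ := by
      change ‖Fintype.linearCombination ℝ b _‖ = _
      rw [map_sum, hg]
      simp
    have h4 : ‖∑ k, s k • (Pi.single (Sum.inl k) 1 : Fin n ⊕ Fin m → ℝ)‖ ≤ ‖s‖ := by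
      refine (pi_norm_le_iff_of_nonneg (norm_nonneg _)).2 fun k => ?_
      rcases k with k | k
      · simpa [Finset.sum_apply, Pi.single_apply] using norm_le_pi_norm s k
      · simp [Finset.sum_apply]
    rw [hpκ, ← not_le] at hs
    rw [h3] at h2
    refine hs ((abs_sub_le _ ‖∑ k, s k • g k‖ _).trans ((add_le_add h1 (h2.trans
      (mul_le_mul_of_nonneg_left h4 hε₀.le))).trans (le_of_eq ?_)))
    rw [Fintype.card_fin]
    linear_combination ‖s‖ * hε₁
  · let g' : Fin n ⊕ Fin m → UniformSpace.Completion X :=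
      fun k => κ (Sum.elim (fun k => ratSeq (u k)) w k)
    let M : Seminorm ℝ (Fin n ⊕ Fin m → ℝ) :=
      (normSeminorm ℝ _).comp (Fintype.linearCombination ℝ g')
    have hM : ∀ s, M s = ‖∑ k, s k • g' k‖ := fun s => by
      rw [← Fintype.linearCombination_apply]; rfl
    have h1 : ∀ s, |M s - N' s| ≤ 2 * ε * ‖s‖ := Seminorm.abs_sub_le_of_closedBall fun s hs => by
      rw [hM, ← hpκ]; exact (hw s hs).le
    refine ⟨g', fun k => (hu k).le.trans (by linarith), fun s => ?_⟩
    rw [← hM, ← hN]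
    have h2 := abs_sub_le (M s) (N' s) (N s)
    have h3 := h1 s
    have h4 := hNN' s
    rw [abs_sub_comm] at h4
    nlinarith [norm_nonneg s]

end MetricFraisse

theorem mainTheorem6 :
    MetricFraisse.IsFraisseClass MetricFraisse.finDimBanach.{u} ∧
    (∀ (G : Type u) [NormedAddCommGroup G] [NormedSpace ℝ G] [CompleteSpace G],
      MetricFraisse.IsGurarij G ↔
        MetricFraisse.IsFraisseLimit MetricFraisse.finDimBanach.{u}
          (MetricFraisse.banachStructure G)) ∧
    (∃ (G : Type u) (_ : NormedAddCommGroup G) (_ : NormedSpace ℝ G),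
      MetricFraisse.IsGurarij G) ∧
    (∀ (G H : Type u) [NormedAddCommGroup G] [NormedSpace ℝ G]
      [NormedAddCommGroup H] [NormedSpace ℝ H],
      MetricFraisse.IsGurarij G → MetricFraisse.IsGurarij H → Nonempty (G ≃ₗᵢ[ℝ] H)) ∧
    (∀ (G X : Type u) [NormedAddCommGroup G] [NormedSpace ℝ G]
      [NormedAddCommGroup X] [NormedSpace ℝ X] [CompleteSpace X]
      [TopologicalSpace.SeparableSpace X],
      MetricFraisse.IsGurarij G → Nonempty (X →ₗᵢ[ℝ] G)) :=
  ⟨MetricFraisse.isFraisseClass_finDimBanach,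
    fun _ _ _ _ => MetricFraisse.isGurarij_iff_isFraisseLimit,
    MetricFraisse.exists_isGurarij,
    fun _ _ _ _ _ _ hG hH => hG.nonempty_linearIsometryEquiv hH,
    fun _ _ _ _ _ _ _ _ hG => hG.exists_linearIsometry⟩
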